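/- Let $\mu$ be the Haar (uniform, unitarily invariant) probability measure on the unit sphere of $\mathbb{C}^2$, and let $\psi$ be $\mu$-distributed. For a Hermitian $2\times2$ matrix $M$ put $\langle M\rangle_\psi=\langle\psi|M|\psi\rangle$ and $\Delta_\psi M=\sqrt{\langle M^2\rangle_\psi-\langle M\rangle_\psi^2}$. Let $A=a_0\mathbb{1}+\boldsymbol a\cdot\boldsymbol\sigma$ and $B=b_0\mathbb{1}+\boldsymbol b\cdot\boldsymbol\sigma$, where $a_0,b_0\in\mathbb{R}$, $\boldsymbol a,\boldsymbol b\in\mathbb{R}^3$, $\boldsymbol\sigma=(\sigma_1,\sigma_2,\sigma_3)$ are the Pauli matrices, and $a=|\boldsymbol a|>0$, $b=|\boldsymbol b|>0$. Let $r_\pm(x)=a_0\pm\sqrt{a^2-x^2}$ and $s_\pm(y)=b_0\pm\sqrt{b^2-y^2}$, and let $f_{\langle A\rangle,\langle B\rangle}$ be the joint probability density of $(\langle A\rangle_\psi,\langle B\rangle_\psi)$ on $\mathbb{R}^2$, which may be a generalized function (i.e. a measure). Then the joint probability density of $(\Delta_\psi A,\Delta_\psi B)$ is $$f_{\Delta A,\Delta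 B}(x,y)=\frac{2xy\,\sum_{j\in\{+,-\}}f_{\langle A\rangle,\langle B\rangle}(r_+(x),s_j(y))}{\sqrt{(a^2-x^2)(b^2-y^2)}}$$ for $0<x<a$, $0<y<b$, and it vanishes elsewhere. Here, if $\nu$ is a measure on $\mathbb{R}^2$ and $\varphi$ maps an open set $U\subset\mathbb{R}^2$ diffeomorphically onto its image, the composite $\nu\circ\varphi$ is the measure $E\mapsto\int_{\varphi(E)}|\det D(\varphi^{-1})|\,d\nu$ on $U$ (so $\nu\circ\varphi$ has density $f\circ\varphi$ if $\nu$ has density $f$); the formula says that the law of $(\Delta_\psi A,\Delta_\psi B)$ is the measure obtained in this way on $U=(0,a)\times(0,b)$ from the law of $(\langle A\rangle_\psi,\langle B\rangle_\psi)$. Moreover: (i) If $\boldsymbol a,\boldsymbol b$ are linearly independent, then both pairs have probability densities with respect to Lebesgue measure on $\mathbb{R}^2$, the formula holds for almost every $(x,y)\in[0,a)\times[0,b)$ as an identity of functions (with $f_{\Delta A,\Delta B}=0$ almost everywhere outside this set), and for almost every $(r,s)$ $$f_{\langle A\rangle,\langle B\rangle}(r,s)=\frac{H(1-\omega(r,s))}{2\pi\sqrt{\det(T)\,(1-\omega(r,s)^2)}},\qquad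 \omega(r,s)=\sqrt{(r-a_0,\,s-b_0)\,T^{-1}\,(r-a_0,\,s-b_0)^{\mathsf T}},$$ where $T$ is the Gram matrix of $(\boldsymbol a,\boldsymbol b)$ and $H(t)=1$ for $t>0$, $H(t)=0$ otherwise (the right-hand side being $0$ where $\omega(r,s)\ge1$). (ii) If $\boldsymbol b=\kappa\boldsymbol a$ with $\kappa\in\mathbb{R}$, then $f_{\langle A\rangle,\langle B\rangle}(r,s)=\delta\big((s-b_0)-\kappa(r-a_0)\big)\,\frac1{2a}\mathbf 1_{[a_0-a,a_0+a]}(r)$; that is, $(\langle A\rangle_\psi,\langle B\rangle_\psi)$ has the law of $(R,\,b_0+\kappa(R-a_0))$ with $R$ uniformly distributed on $[a_0-a,a_0+a]$. -/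

import Mathlib

open MeasureTheory
open scoped Matrix ENNReal

noncomputable section

namespace QubitUncertainty

/-- The state space `ℂ²` of a qubit, with its Hermitian norm. -/
abbrev Qubit : Type := EuclideanSpace ℂ (Fin 2)

/-- The pure states: unit vectors of `ℂ²`. -/
abbrev PureState : Type := Metric.sphere (0 : Qubit) 1

/-- The law of a Haar-distributed random pure state: the uniform (unitarily invariant) probability
measure on the unit sphere of `ℂ²`, i.e. the surface measure divided by its total mass. -/
def haarState : Measure PureState :=
  ((volume : Measure Qubit).toSphere Set.univ)⁻¹ • (volume : Measure Qubit).toSphere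

instance : IsProbabilityMeasure haarState := by
  have h : NeZero ((volume : Measure Qubit).toSphere) := by
    refine ⟨fun h0 => ?_⟩
    have h1 := Measure.toSphere_apply_univ (volume : Measure Qubit)
    rw [h0] at h1
    have h2 : (volume : Measure Qubit) (Metric.ball 0 1) ≠ 0 :=
      (Metric.measure_ball_pos _ _ one_pos).ne'
    have h3 : (Module.finrank ℝ Qubit : ℝ≥0∞) ≠ 0 :=
      Nat.cast_ne_zero.2 Module.finrank_pos.ne'
    exact mul_ne_zero h3 h2 (by simpa using h1.symm)
  have h4 : (volume : Measure Qubit).toSphere Set.univ ≠ 0 :=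
    fun h0 => h.out (Measure.measure_univ_eq_zero.1 h0)
  refine ⟨?_⟩
  rw [haarState, Measure.smul_apply, smul_eq_mul]
  exact ENNReal.inv_mul_cancel h4 (measure_ne_top _ _)

/-- The Pauli matrices `σ₁, σ₂, σ₃`. -/
def pauli : Fin 3 → Matrix (Fin 2) (Fin 2) ℂ :=
  ![!![0, 1; 1, 0], !![0, -Complex.I; Complex.I, 0], !![1, 0; 0, -1]]

/-- The qubit observable `c₀ 𝟙 + c · σ`. -/
def observable (c₀ : ℝ) (c : EuclideanSpace ℝ (Fin 3)) : Matrix (Fin 2) (Fin 2) ℂ :=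
  (c₀ : ℂ) • 1 + ∑ i, (c i : ℂ) • pauli i

/-- The expectation value `⟨ψ|M|ψ⟩` (its real part, which is all of it for Hermitian `M`). -/
def expect (M : Matrix (Fin 2) (Fin 2) ℂ) (ψ : PureState) : ℝ :=
  (star (ψ.1 : Fin 2 → ℂ) ⬝ᵥ M *ᵥ (ψ.1 : Fin 2 → ℂ)).re

/-- The uncertainty (standard deviation) `Δ_ψ M = (⟨M²⟩_ψ - ⟨M⟩_ψ²)^{1/2}`. -/
def uncertainty (M : Matrix (Fin 2) (Fin 2) ℂ) (ψ : PureState) : ℝ :=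
  Real.sqrt (expect (M * M) ψ - expect M ψ ^ 2)

/-- `(⟨A⟩_ψ, ⟨B⟩_ψ)`. -/
def expectPair (A B : Matrix (Fin 2) (Fin 2) ℂ) (ψ : PureState) : ℝ × ℝ :=
  (expect A ψ, expect B ψ)

/-- `(Δ_ψ A, Δ_ψ B)`. -/
def uncertaintyPair (A B : Matrix (Fin 2) (Fin 2) ℂ) (ψ : PureState) : ℝ × ℝ :=
  (uncertainty A ψ, uncertainty B ψ)

/-- `c₀ + √(ℓ² - x²)`, i.e. `r₊(x)` for `(c₀, ℓ) = (a₀, a)` and `s₊(x)` for `(b₀, b)`. -/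
def rootPlus (c₀ ℓ x : ℝ) : ℝ := c₀ + Real.sqrt (ℓ ^ 2 - x ^ 2)

/-- `c₀ - √(ℓ² - x²)`, i.e. `r₋(x)` for `(c₀, ℓ) = (a₀, a)` and `s₋(x)` for `(b₀, b)`. -/
def rootMinus (c₀ ℓ x : ℝ) : ℝ := c₀ - Real.sqrt (ℓ ^ 2 - x ^ 2)

/-- The weight `2xy / √((ℓ² - x²)(m² - y²))`. -/
def weight (ℓ m : ℝ) (p : ℝ × ℝ) : ℝ≥0∞ :=
  ENNReal.ofReal (2 * p.1 * p.2 / Real.sqrt ((ℓ ^ 2 - p.1 ^ 2) * (m ^ 2 - p.2 ^ 2)))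

/-- The Gram matrix `T_{a,b}`. -/
def gramMatrix (a b : EuclideanSpace ℝ (Fin 3)) : Matrix (Fin 2) (Fin 2) ℝ :=
  !![inner ℝ a a, inner ℝ a b; inner ℝ b a, inner ℝ b b]

/-- `ω_{A,B}(r,s) = √((r - a₀, s - b₀) T_{a,b}⁻¹ (r - a₀, s - b₀)ᵀ)`. -/
def omega (a₀ b₀ : ℝ) (a b : EuclideanSpace ℝ (Fin 3)) (p : ℝ × ℝ) : ℝ :=
  Real.sqrt (![p.1 - a₀, p.2 - b₀] ⬝ᵥ (gramMatrix a b)⁻¹ *ᵥ ![p.1 - a₀, p.2 - b₀])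

/-- The Heaviside function, with value `0` at `0`. -/
def heaviside (t : ℝ) : ℝ := if 0 < t then 1 else 0

/-- `H(1 - ω) / (2π √(det T (1 - ω²)))`, for linearly independent `a`, `b`. -/
def expectDensity (a₀ b₀ : ℝ) (a b : EuclideanSpace ℝ (Fin 3)) (p : ℝ × ℝ) : ℝ≥0∞ :=
  ENNReal.ofReal (heaviside (1 - omega a₀ b₀ a b p) /
    (2 * Real.pi * Real.sqrt ((gramMatrix a b).det * (1 - omega a₀ b₀ a b p ^ 2))))

/-- The composite `ν ∘ φ` on `U` of a generalized function on the plane (a measure `ν`, thought of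
as a density that may contain delta functions) with a map `φ` that is a diffeomorphism from the open
set `U` onto its image. It is the measure on `U` given by `E ↦ ∫_{φ(E)} |det D(φ⁻¹)| dν`, so that
for `ν = f(r,s) dr ds` it is `f(φ(x,y)) dx dy` on `U`, and `δ_{φ(p)} ∘ φ = |det Dφ(p)|⁻¹ δ_p`. -/
def genComp (U : Set (ℝ × ℝ)) (φ : ℝ × ℝ → ℝ × ℝ) (ν : Measure (ℝ × ℝ)) : Measure (ℝ × ℝ) :=
  ((ν.comap (fun p : U => φ p)).map Subtype.val).withDensity
    (fun p => ENNReal.ofReal (|(fderiv ℝ φ p).det|⁻¹))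

end QubitUncertainty

end

open QubitUncertainty

/-!
For a Haar-distributed pure state `ψ` of a qubit, the outcome probabilities in any orthonormal
basis are uniform: the cone over `{ψ | |ψ₀|² ≤ t}` in the unit ball of `ℂ²` corresponds under
`(z, w) ↦ (|z|², |w|²)`, which pushes Lebesgue measure forward to `π²` times area, to a triangle of
area `t / 2` (`map_basis_haarState`). Applied to an eigenbasis of `c · σ`, whose eigenvalues are
`±‖c‖`, this shows that `⟨c · σ⟩_ψ` is uniform on `[-‖c‖, ‖c‖]` for every Bloch vector `c`
(`map_expect_observable_zero`).

Since `c ↦ ⟨c · σ⟩_ψ` is linear, every linear functional of the pair of expectation values of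
`a · σ` and `b · σ` is again of this kind, so that by the Cramér–Wold principle
(`ext_of_map_linear_functional`) the joint law is known: it is the only one for which the image
under `(r, s) ↦ u r + v s` is uniform on `[-ℓ, ℓ]` with `ℓ = ‖u a + v b‖`. In particular it is
symmetric (`map_reflect_map_expectPair`). On the other hand, the density `1 / (2π √(1 - x² - y²))`
on the unit disk is invariant under rotations and has uniform marginals, so that a linear
functional `(x, y) ↦ u x + v y` is uniform on `[-ℓ, ℓ]` with `ℓ² = u² + v²`
(`map_linear_functional_diskDensity`). For linearly independent `a`, `b`, the Cholesky factor of
the Gram matrix turns this family of marginals into the former, and hence turns the disk density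
into the joint density of the expectation values (`map_expectPair_eq_withDensity`).

Finally `(c · σ)² = ‖c‖² 𝟙` gives `Δ_ψ C = √(‖c‖² - (⟨C⟩_ψ - c₀)²)`, so that the pair of
uncertainties is a function of the pair of expectation values. This function is a diffeomorphism
on each of four quadrants around `(a₀, b₀)`, which carry all the mass; opposite quadrants
contribute equally by symmetry (`map_deviation_eq_two_smul`), and on each of the two quadrants
with `r > a₀` the weight is twice the Jacobian of the inverse
(`IsInverseBranch.genComp_withDensity_weight`).
-/

namespace QubitUncertainty

open scoped Pointwise

/-! ### The uniform measure on `[-1, 1]` -/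

/-- The uniform probability measure on `[-1, 1]`. -/
noncomputable def uniformIcc : Measure ℝ :=
  ENNReal.ofReal (1 / 2) • volume.restrict (Set.Icc (-1) 1)

lemma uniformIcc_Iic (u : ℝ) :
    uniformIcc (Set.Iic u) = ENNReal.ofReal (min ((1 + u) / 2) 1) := by
  have h : Set.Iic u ∩ Set.Icc (-1) 1 = Set.Icc (-1) (min u 1) := by
    ext x; simp only [Set.mem_inter_iff, Set.mem_Iic, Set.mem_Icc, le_min_iff]; tauto
  rw [uniformIcc, Measure.smul_apply, Measure.restrict_apply measurableSet_Iic, h,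
    Real.volume_Icc, smul_eq_mul, ← ENNReal.ofReal_mul (by norm_num)]
  congr 1
  rcases le_total u 1 with h1 | h1
  · rw [min_eq_left h1, min_eq_left (by linarith)]; ring
  · rw [min_eq_right h1, min_eq_right (by linarith)]; ring

instance : IsProbabilityMeasure uniformIcc := by
  refine ⟨?_⟩
  rw [uniformIcc, Measure.smul_apply, Measure.restrict_apply_univ, Real.volume_Icc, smul_eq_mul,
    ← ENNReal.ofReal_mul (by norm_num)]
  norm_num

lemma map_neg_uniformIcc : uniformIcc.map (fun x => -x) = uniformIcc := by
  have h : MeasurePreserving (fun x : ℝ => -x)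
      (volume.restrict ((fun x : ℝ => -x) ⁻¹' Set.Icc (-1) 1))
      (volume.restrict (Set.Icc (-1) 1)) :=
    (Measure.measurePreserving_neg (volume : Measure ℝ)).restrict_preimage measurableSet_Icc
  have h2 : (fun x : ℝ => -x) ⁻¹' Set.Icc (-1) 1 = Set.Icc (-1) 1 := by
    ext x
    simp only [Set.mem_preimage, Set.mem_Icc]
    constructor <;> rintro ⟨_, _⟩ <;> constructor <;> linarith
  rw [uniformIcc, Measure.map_smul]
  rw [h2] at h
  rw [h.map_eq]

lemma uniformIcc_map_mul_abs (r : ℝ) :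
    uniformIcc.map (fun x => |r| * x) = uniformIcc.map (fun x => r * x) := by
  rcases abs_choice r with h | h
  · rw [h]
  · rw [h]
    conv_rhs => rw [← map_neg_uniformIcc, Measure.map_map (by fun_prop) (by fun_prop)]
    congr 1; ext x; simp

/-! ### Outcome probabilities of a random state in an orthonormal basis -/

/-- The image of Lebesgue measure on `ℂ` under `z ↦ ‖z‖²` is `π` times Lebesgue measure on
`[0, ∞)`. -/
lemma map_norm_sq_volume_complex :
    (volume : Measure ℂ).map (fun z => ‖z‖ ^ 2) =
      ENNReal.ofReal Real.pi • volume.restrict (Set.Ici 0) := by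
  symm
  refine Measure.ext_of_Ico' _ _ (fun a b _ => ?_) fun a b hab => ?_
  · rw [Measure.smul_apply, smul_eq_mul]
    exact ENNReal.mul_ne_top ENNReal.ofReal_ne_top
      ((Measure.restrict_apply_le _ _).trans_lt measure_Ico_lt_top).ne
  rw [Measure.map_apply (by fun_prop) measurableSet_Ico]
  have h : (fun z : ℂ => ‖z‖ ^ 2) ⁻¹' Set.Ico a b =
      Metric.ball 0 (Real.sqrt b) \ Metric.ball 0 (Real.sqrt a) := by
    ext z
    simp only [Set.mem_preimage, Set.mem_Ico, Set.mem_sdiff, Metric.mem_ball, dist_zero_right,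
      not_lt, Real.lt_sqrt (norm_nonneg z)]
    tauto
  have h2 : Set.Ico a b ∩ Set.Ici 0 = Set.Ico (max a 0) b := by
    ext x; simp only [Set.mem_inter_iff, Set.mem_Ico, Set.mem_Ici, max_le_iff]; tauto
  rw [h, measure_sdiff (Metric.ball_subset_ball (Real.sqrt_le_sqrt hab.le))
    measurableSet_ball.nullMeasurableSet measure_ball_lt_top.ne, Complex.volume_ball,
    Complex.volume_ball, Measure.smul_apply, Measure.restrict_apply measurableSet_Ico, h2,
    Real.volume_Ico, smul_eq_mul, ← ENNReal.ofReal_pow (Real.sqrt_nonneg _),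
    ← ENNReal.ofReal_pow (Real.sqrt_nonneg _), mul_comm]
  have hp : (NNReal.pi : ℝ≥0∞) = ENNReal.ofReal Real.pi := by
    rw [← NNReal.coe_real_pi, ENNReal.ofReal_coe_nnreal]
  rw [hp, ← ENNReal.sub_mul (fun _ _ => ENNReal.ofReal_ne_top),
    ← ENNReal.ofReal_sub _ (by positivity)]
  congr 1
  rcases le_total b 0 with hb | hb
  · rw [ENNReal.ofReal_eq_zero.2 (by linarith [le_max_right a 0]), ENNReal.ofReal_eq_zero.2]
    rw [Real.sqrt_eq_zero_of_nonpos hb]; nlinarith [sq_nonneg (Real.sqrt a)]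
  · rw [Real.sq_sqrt hb]
    rcases le_total a 0 with ha | ha
    · rw [max_eq_right ha, Real.sqrt_eq_zero_of_nonpos ha]; norm_num
    · rw [max_eq_left ha, Real.sq_sqrt ha]

/-- The area of the region that corresponds, under `(p, q) = (|z|², |w|²)`, to the part of the
punctured open unit ball of `ℂ²` where `|z|² ≤ t (|z|² + |w|²)`. The shear `(p, q) ↦ (p, p + q)`
takes it to `0 ≤ p ≤ min t 1 * s`, `0 < s < 1`. -/
lemma volume_shear_triangle (t : ℝ) :
    ((volume.restrict (Set.Ici (0 : ℝ))).prod (volume.restrict (Set.Ici (0 : ℝ))))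
      {p : ℝ × ℝ | 0 < p.1 + p.2 ∧ p.1 + p.2 < 1 ∧ p.1 ≤ t * (p.1 + p.2)} =
      ENNReal.ofReal (min t 1) * ENNReal.ofReal (1 / 2) := by
  have hS : MeasurableSet {p : ℝ × ℝ | 0 < p.2 ∧ p.2 < 1 ∧ 0 ≤ p.1 ∧ p.1 ≤ min t 1 * p.2} := by
    measurability
  have hT : MeasurableSet {p : ℝ × ℝ | 0 < p.1 + p.2 ∧ p.1 + p.2 < 1 ∧ p.1 ≤ t * (p.1 + p.2)} := by
    measurability
  have hpre : {p : ℝ × ℝ | 0 < p.1 + p.2 ∧ p.1 + p.2 < 1 ∧ p.1 ≤ t * (p.1 + p.2)} ∩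
      Set.Ici 0 ×ˢ Set.Ici 0 = (fun z : ℝ × ℝ => (z.1, z.1 + z.2)) ⁻¹'
        {p : ℝ × ℝ | 0 < p.2 ∧ p.2 < 1 ∧ 0 ≤ p.1 ∧ p.1 ≤ min t 1 * p.2} := by
    ext ⟨p, q⟩
    simp only [Set.mem_inter_iff, Set.mem_ofPred_eq, Set.mem_prod, Set.mem_Ici, Set.mem_preimage]
    constructor
    · rintro ⟨⟨h1, h2, h3⟩, h4, h5⟩
      refine ⟨h1, h2, h4, ?_⟩
      rw [min_mul_of_nonneg _ _ h1.le]
      exact le_min h3 (by linarith)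
    · rintro ⟨h1, h2, h3, h4⟩
      rw [min_mul_of_nonneg _ _ h1.le, le_min_iff] at h4
      exact ⟨⟨h1, h2, h4.1⟩, h3, by linarith [h4.2]⟩
  rw [Measure.prod_restrict, Measure.restrict_apply hT, hpre,
    (measurePreserving_prod_add volume volume).measure_preimage hS.nullMeasurableSet,
    Measure.prod_apply_symm hS]
  have hsec : ∀ s : ℝ, volume ((fun x => (x, s)) ⁻¹'
      {p : ℝ × ℝ | 0 < p.2 ∧ p.2 < 1 ∧ 0 ≤ p.1 ∧ p.1 ≤ min t 1 * p.2}) =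
      (Set.Ioo (0 : ℝ) 1).indicator (fun s => ENNReal.ofReal (min t 1) * ENNReal.ofReal s) s := by
    intro s
    by_cases hs : s ∈ Set.Ioo (0 : ℝ) 1
    · have : ((fun x => (x, s)) ⁻¹'
          {p : ℝ × ℝ | 0 < p.2 ∧ p.2 < 1 ∧ 0 ≤ p.1 ∧ p.1 ≤ min t 1 * p.2}) =
          Set.Icc 0 (min t 1 * s) := by
        ext x; simp [hs.1, hs.2]
      rw [this, Set.indicator_of_mem hs, Real.volume_Icc, sub_zero, ENNReal.ofReal_mul' hs.1.le]
    · have : ((fun x => (x, s)) ⁻¹'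
          {p : ℝ × ℝ | 0 < p.2 ∧ p.2 < 1 ∧ 0 ≤ p.1 ∧ p.1 ≤ min t 1 * p.2}) = ∅ := by
        ext x
        simp only [Set.mem_preimage, Set.mem_ofPred_eq, Set.mem_empty_iff_false, iff_false]
        exact fun h => hs ⟨h.1, h.2.1⟩
      rw [this, Set.indicator_of_notMem hs, measure_empty]
  simp_rw [hsec]
  rw [lintegral_indicator measurableSet_Ioo, lintegral_const_mul _ (by fun_prop),
    ← ofReal_integral_eq_lintegral_ofReal, ← integral_Ioc_eq_integral_Ioo,
    ← intervalIntegral.integral_of_le zero_le_one]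
  · norm_num
  · exact (continuous_id.integrableOn_Icc (a := (0 : ℝ)) (b := 1)).mono_set Set.Ioo_subset_Icc_self
  · exact (ae_restrict_iff' measurableSet_Ioo).2 (Filter.Eventually.of_forall fun x hx => hx.1.le)

/-- The coordinates of an orthonormal basis of `ℂ²`, as a map to `ℂ × ℂ`, preserve volume. -/
lemma measurePreserving_repr_prod (e : OrthonormalBasis (Fin 2) ℂ Qubit) :
    MeasurePreserving (fun x : Qubit => (e.repr x 0, e.repr x 1)) volume
      ((volume : Measure ℂ).prod volume) := by
  let l : Qubit ≃ₗ[ℝ] WithLp 2 (ℂ × ℂ) :=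
    { toFun := fun x => WithLp.toLp 2 (e.repr x 0, e.repr x 1)
      invFun := fun z => e.repr.symm (WithLp.toLp 2 ![z.fst, z.snd])
      map_add' := fun x y => by
        apply WithLp.ofLp_injective 2; ext : 1 <;> simp
      map_smul' := fun r x => by
        have : e.repr (r • x) = r • e.repr x := by
          have := e.repr.map_smul (r : ℂ) x
          simpa using this
        apply WithLp.ofLp_injective 2; ext : 1 <;> simp [this]
      left_inv := fun x => by
        apply e.repr.injective
        simp only [LinearIsometryEquiv.apply_symm_apply]
        ext i; fin_cases i <;> simp
      right_inv := fun z => by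
        apply WithLp.ofLp_injective 2; ext : 1 <;> simp }
  let L : Qubit ≃ₗᵢ[ℝ] WithLp 2 (ℂ × ℂ) :=
    { l with
      norm_map' := fun x => by
        have h1 := WithLp.prod_norm_sq_eq_of_L2 (l x)
        have h2 := EuclideanSpace.norm_sq_eq (e.repr x)
        rw [Fin.sum_univ_two, e.repr.norm_map] at h2
        have h3 : ‖l x‖ ^ 2 = ‖x‖ ^ 2 := by rw [h1, h2]; rfl
        exact (sq_eq_sq₀ (norm_nonneg _) (norm_nonneg _)).1 h3 }
  exact (WithLp.volume_preserving_ofLp ℂ ℂ).comp L.measurePreserving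

/-- In any orthonormal basis, the difference of the two outcome probabilities of a Haar-distributed
state is uniform on `[-1, 1]`. -/
lemma map_basis_haarState (e : OrthonormalBasis (Fin 2) ℂ Qubit) :
    haarState.map (fun ψ => ‖e.repr ψ.1 0‖ ^ 2 - ‖e.repr ψ.1 1‖ ^ 2) = uniformIcc := by
  have hm : Measurable (fun ψ : PureState => ‖e.repr ψ.1 0‖ ^ 2 - ‖e.repr ψ.1 1‖ ^ 2) := by
    have : Continuous (fun ψ : PureState => e.repr ψ.1) :=
      e.repr.continuous.comp continuous_subtype_val
    have h : Continuous (fun ψ : PureState => ‖e.repr ψ.1 0‖ ^ 2 - ‖e.repr ψ.1 1‖ ^ 2) := by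
      fun_prop
    exact h.measurable
  have hnorm : ∀ x : Qubit, ‖x‖ ^ 2 = ‖e.repr x 0‖ ^ 2 + ‖e.repr x 1‖ ^ 2 := fun x => by
    rw [← e.repr.norm_map, EuclideanSpace.norm_sq_eq, Fin.sum_univ_two]
  have hsmul : ∀ (r : ℝ) (x : Qubit) (i : Fin 2),
      ‖e.repr (r • x) i‖ ^ 2 = r ^ 2 * ‖e.repr x i‖ ^ 2 := by
    intro r x i
    have : e.repr (r • x) = (r : ℂ) • e.repr x := by
      rw [← e.repr.map_smul]; congr 1
    rw [this]
    simp [mul_pow]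
  -- the cone over a sublevel set, in the coordinates `(|z|², |w|²)`
  have hcone : ∀ u : ℝ, (volume : Measure Qubit).toSphere
      ((fun ψ : PureState => ‖e.repr ψ.1 0‖ ^ 2 - ‖e.repr ψ.1 1‖ ^ 2) ⁻¹' Set.Iic u) =
      (Module.finrank ℝ Qubit : ℝ≥0∞) * (ENNReal.ofReal Real.pi * ENNReal.ofReal Real.pi *
        ENNReal.ofReal (1 / 2)) * ENNReal.ofReal (min ((1 + u) / 2) 1) := by
    intro u
    have hset : (Set.Ioo (0 : ℝ) 1 • (Subtype.val ''
        ((fun ψ : PureState => ‖e.repr ψ.1 0‖ ^ 2 - ‖e.repr ψ.1 1‖ ^ 2) ⁻¹'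
          Set.Iic u)) : Set Qubit) =
        (fun x : Qubit => (e.repr x 0, e.repr x 1)) ⁻¹'
          (Prod.map (fun z : ℂ => ‖z‖ ^ 2) (fun z : ℂ => ‖z‖ ^ 2) ⁻¹'
            {p : ℝ × ℝ | 0 < p.1 + p.2 ∧ p.1 + p.2 < 1 ∧ p.1 ≤ (1 + u) / 2 * (p.1 + p.2)}) := by
      ext x
      simp only [Set.mem_smul, Set.mem_image, Set.mem_preimage, Set.mem_Iic, Prod.map_apply,
        Set.mem_ofPred_eq, ← hnorm]
      constructor
      · rintro ⟨r, hr, _, ⟨ψ, hψ, rfl⟩, rfl⟩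
        have h1 : ‖(ψ : Qubit)‖ = 1 := norm_eq_of_mem_sphere ψ
        have h2 : ‖r • (ψ : Qubit)‖ ^ 2 = r ^ 2 := by
          rw [norm_smul, h1, mul_one, Real.norm_eq_abs, sq_abs]
        have h3 := hnorm ψ.1
        rw [h1] at h3
        rw [h2, hsmul]
        have hr2 : 0 < r ^ 2 := by have := hr.1; positivity
        refine ⟨hr2, by nlinarith [hr.1, hr.2], ?_⟩
        rw [mul_comm]
        exact mul_le_mul_of_nonneg_right (by linarith) hr2.le
      · rintro ⟨h1, h2, h3⟩
        have hx : 0 < ‖x‖ := by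
          rcases (norm_nonneg x).eq_or_lt with h | h
          · rw [← h] at h1; norm_num at h1
          · exact h
        have hx1 : ‖x‖ < 1 := by nlinarith
        refine ⟨‖x‖, ⟨hx, hx1⟩, ‖x‖⁻¹ • x, ⟨⟨‖x‖⁻¹ • x, ?_⟩, ?_, rfl⟩, ?_⟩
        · rw [mem_sphere_zero_iff_norm, norm_smul, norm_inv, norm_norm, inv_mul_cancel₀ hx.ne']
        · simp only [hsmul]
          rw [← mul_sub, inv_pow, inv_mul_le_iff₀ (by positivity)]
          linarith [hnorm x]
        · rw [smul_smul, mul_inv_cancel₀ hx.ne', one_smul]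
    have hT : MeasurableSet
        {p : ℝ × ℝ | 0 < p.1 + p.2 ∧ p.1 + p.2 < 1 ∧ p.1 ≤ (1 + u) / 2 * (p.1 + p.2)} := by
      measurability
    have hsq : Measurable (fun z : ℂ => ‖z‖ ^ 2) := by fun_prop
    rw [Measure.toSphere_apply' _ (hm measurableSet_Iic), hset,
      (measurePreserving_repr_prod e).measure_preimage
        (((hsq.prodMap hsq) hT).nullMeasurableSet),
      ← Measure.map_apply (hsq.prodMap hsq) hT, ← Measure.map_prod_map _ _ hsq hsq,
      map_norm_sq_volume_complex, Measure.prod_smul_left, Measure.prod_smul_right,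
      Measure.smul_apply, Measure.smul_apply, volume_shear_triangle, smul_eq_mul, smul_eq_mul]
    ring
  have huniv : (volume : Measure Qubit).toSphere Set.univ =
      (Module.finrank ℝ Qubit : ℝ≥0∞) * (ENNReal.ofReal Real.pi * ENNReal.ofReal Real.pi *
        ENNReal.ofReal (1 / 2)) := by
    have h := hcone 1
    have h2 : (fun ψ : PureState => ‖e.repr ψ.1 0‖ ^ 2 - ‖e.repr ψ.1 1‖ ^ 2) ⁻¹' Set.Iic 1 =
        Set.univ := by
      refine Set.eq_univ_of_forall fun ψ => ?_
      have h1 : ‖(ψ : Qubit)‖ = 1 := norm_eq_of_mem_sphere ψ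
      have h3 := hnorm ψ.1
      rw [h1] at h3
      simp only [Set.mem_preimage, Set.mem_Iic]
      nlinarith [sq_nonneg ‖e.repr ψ.1 1‖]
    rw [h2] at h
    rw [h]; norm_num
  have : IsProbabilityMeasure
      (haarState.map (fun ψ => ‖e.repr ψ.1 0‖ ^ 2 - ‖e.repr ψ.1 1‖ ^ 2)) :=
    Measure.isProbabilityMeasure_map hm.aemeasurable
  refine Measure.ext_of_Iic _ _ fun u => ?_
  rw [Measure.map_apply hm measurableSet_Iic, haarState, Measure.smul_apply, smul_eq_mul, hcone,
    huniv, uniformIcc_Iic, ← mul_assoc, ENNReal.inv_mul_cancel, one_mul]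
  · have : (Module.finrank ℝ Qubit : ℝ≥0∞) ≠ 0 := Nat.cast_ne_zero.2 Module.finrank_pos.ne'
    have hpi : ENNReal.ofReal Real.pi ≠ 0 := by simpa using Real.pi_pos
    have hh : ENNReal.ofReal (1 / 2) ≠ 0 := by simp
    exact mul_ne_zero this (mul_ne_zero (mul_ne_zero hpi hpi) hh)
  · finiteness

/-! ### Qubit observables and their expectation values -/

lemma isHermitian_observable (c₀ : ℝ) (c : EuclideanSpace ℝ (Fin 3)) :
    (observable c₀ c).IsHermitian := by
  ext i j
  fin_cases i <;> fin_cases j <;>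
    simp [observable, pauli, Fin.sum_univ_three, Matrix.conjTranspose_apply]

lemma expect_eq_re_inner (M : Matrix (Fin 2) (Fin 2) ℂ) (ψ : PureState) :
    expect M ψ = (inner ℂ ψ.1 (M.toEuclideanLin ψ.1)).re := by
  simp only [expect, EuclideanSpace.inner_eq_star_dotProduct, Matrix.ofLp_toLpLin,
    Matrix.toLin'_apply, dotProduct_comm]

/-- A quantum expectation value is the mean of the eigenvalues, weighted by the outcome
probabilities in an orthonormal eigenbasis. -/
lemma expect_eq_sum_eigenvalues {M : Matrix (Fin 2) (Fin 2) ℂ} (hM : M.IsHermitian)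
    (ψ : PureState) :
    expect M ψ = ∑ i, hM.eigenvalues i * ‖hM.eigenvectorBasis.repr ψ.1 i‖ ^ 2 := by
  have hsymm := Matrix.isSymmetric_toEuclideanLin_iff.2 hM
  have he : ∀ i, M.toEuclideanLin (hM.eigenvectorBasis i) =
      (hM.eigenvalues i : ℂ) • hM.eigenvectorBasis i := fun i => by
    apply WithLp.ofLp_injective 2
    rw [Matrix.ofLp_toLpLin, Matrix.toLin'_apply, hM.mulVec_eigenvectorBasis]
    rfl
  rw [expect_eq_re_inner, ← hM.eigenvectorBasis.sum_inner_mul_inner, Complex.re_sum]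
  refine Finset.sum_congr rfl fun i _ => ?_
  rw [← hsymm, he, inner_smul_left, Complex.conj_ofReal, mul_left_comm, Complex.re_ofReal_mul,
    OrthonormalBasis.repr_apply_apply]
  congr 1
  refine (inner_mul_symm_re_eq_norm (𝕜 := ℂ) ψ.1 (hM.eigenvectorBasis i)).trans ?_
  rw [norm_mul, norm_inner_symm, sq]

lemma expect_observable (c₀ : ℝ) (c : EuclideanSpace ℝ (Fin 3)) (ψ : PureState) :
    expect (observable c₀ c) ψ = c₀ + expect (observable 0 c) ψ := by
  have h : star (ψ.1 : Fin 2 → ℂ) ⬝ᵥ (ψ.1 : Fin 2 → ℂ) = 1 := by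
    have h1 : ‖(ψ : Qubit)‖ = 1 := norm_eq_of_mem_sphere ψ
    have := inner_self_eq_norm_sq_to_K (𝕜 := ℂ) ψ.1
    rw [EuclideanSpace.inner_eq_star_dotProduct, h1, dotProduct_comm] at this
    simpa using this
  simp only [expect, observable, Matrix.add_mulVec, Matrix.smul_mulVec, Matrix.one_mulVec,
    dotProduct_add, dotProduct_smul, h]
  simp

lemma expect_observable_smul_add_smul (a b : EuclideanSpace ℝ (Fin 3)) (u v : ℝ) (ψ : PureState) :
    expect (observable 0 (u • a + v • b)) ψ =
      u * expect (observable 0 a) ψ + v * expect (observable 0 b) ψ := by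
  have h : observable 0 (u • a + v • b) = (u : ℂ) • observable 0 a + (v : ℂ) • observable 0 b := by
    ext i j
    simp [observable, Fin.sum_univ_three]
    ring
  simp only [h, expect, Matrix.add_mulVec, Matrix.smul_mulVec, dotProduct_add, dotProduct_smul,
    smul_eq_mul, Complex.add_re, Complex.re_ofReal_mul]

lemma observable_mul_self (c₀ : ℝ) (c : EuclideanSpace ℝ (Fin 3)) :
    observable c₀ c * observable c₀ c = observable (c₀ ^ 2 + ‖c‖ ^ 2) ((2 * c₀) • c) := by
  have hI := Complex.I_mul_I
  rw [EuclideanSpace.real_norm_sq_eq, Fin.sum_univ_three]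
  ext i j
  fin_cases i <;> fin_cases j <;>
    simp [observable, pauli, Fin.sum_univ_three, Matrix.mul_apply, Fin.sum_univ_two] <;>
    first | ring1 | linear_combination (-(c 1 : ℂ) ^ 2) * hI

/-- On a qubit the uncertainty of an observable is a function of its expectation value, because
`(c · σ)² = ‖c‖² 𝟙`. -/
lemma uncertainty_observable (c₀ : ℝ) (c : EuclideanSpace ℝ (Fin 3)) (ψ : PureState) :
    uncertainty (observable c₀ c) ψ =
      Real.sqrt (‖c‖ ^ 2 - (expect (observable c₀ c) ψ - c₀) ^ 2) := by
  have h : expect (observable 0 ((2 * c₀) • c)) ψ = 2 * c₀ * expect (observable 0 c) ψ := by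
    simpa using expect_observable_smul_add_smul c 0 (2 * c₀) 0 ψ
  rw [uncertainty, observable_mul_self, expect_observable _ ((2 * c₀) • c), h,
    expect_observable c₀ c]
  congr 1; ring

lemma measurable_expect (M : Matrix (Fin 2) (Fin 2) ℂ) : Measurable (expect M) := by
  have : Continuous (expect M) := by
    unfold expect
    simp only [dotProduct, Matrix.mulVec, Pi.star_apply, Fin.sum_univ_two]
    fun_prop
  exact this.measurable

/-- The expectation value of `c · σ` is uniform on `[-‖c‖, ‖c‖]`: the eigenvalues of this matrix are
`±‖c‖`, as its trace is `0` and its determinant `-‖c‖²`. The case `c = 0` is included. -/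
lemma map_expect_observable_zero (c : EuclideanSpace ℝ (Fin 3)) :
    haarState.map (expect (observable 0 c)) = uniformIcc.map (fun x => ‖c‖ * x) := by
  have hM := isHermitian_observable 0 c
  have htr : hM.eigenvalues 0 + hM.eigenvalues 1 = 0 := by
    have h := hM.trace_eq_sum_eigenvalues
    rw [Fin.sum_univ_two] at h
    have h2 : (observable 0 c).trace = 0 := by
      simp [Matrix.trace, observable, pauli, Fin.sum_univ_three]
    rw [h2] at h
    simpa using (congrArg Complex.re h).symm
  have hdet : hM.eigenvalues 0 * hM.eigenvalues 1 = -‖c‖ ^ 2 := by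
    have h := hM.det_eq_prod_eigenvalues
    rw [Fin.prod_univ_two] at h
    have h2 : (observable 0 c).det = ((-‖c‖ ^ 2 : ℝ) : ℂ) := by
      rw [EuclideanSpace.real_norm_sq_eq, Fin.sum_univ_three]
      simp [Matrix.det_fin_two, observable, pauli, Fin.sum_univ_three]
      linear_combination ((c 1 : ℂ) ^ 2) * Complex.I_mul_I
    rw [h2] at h
    simpa [← Complex.ofReal_pow] using (congrArg Complex.re h).symm
  have habs : |hM.eigenvalues 0| = ‖c‖ := by
    rw [← abs_of_nonneg (norm_nonneg c)]
    apply (sq_eq_sq_iff_abs_eq_abs _ _).1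
    have : hM.eigenvalues 1 = -hM.eigenvalues 0 := by linarith
    rw [this] at hdet
    linarith
  have hfun : expect (observable 0 c) = (fun x => hM.eigenvalues 0 * x) ∘
      (fun ψ : PureState => ‖hM.eigenvectorBasis.repr ψ.1 0‖ ^ 2 -
        ‖hM.eigenvectorBasis.repr ψ.1 1‖ ^ 2) := by
    ext ψ
    rw [expect_eq_sum_eigenvalues hM, Fin.sum_univ_two]
    simp only [Function.comp_apply]
    linear_combination ‖hM.eigenvectorBasis.repr ψ.1 1‖ ^ 2 * htr
  have hm : Measurable (fun ψ : PureState => ‖hM.eigenvectorBasis.repr ψ.1 0‖ ^ 2 -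
        ‖hM.eigenvectorBasis.repr ψ.1 1‖ ^ 2) := by
    have : Continuous (fun ψ : PureState => hM.eigenvectorBasis.repr ψ.1) :=
      hM.eigenvectorBasis.repr.continuous.comp continuous_subtype_val
    exact Continuous.measurable (by fun_prop)
  rw [hfun, ← Measure.map_map (by fun_prop) hm, map_basis_haarState, ← habs,
    uniformIcc_map_mul_abs]

/-! ### One-dimensional marginals of the pair of expectation values -/

/-- The Cramér–Wold principle in the plane: a finite measure is determined by its images under
linear functionals. -/
lemma ext_of_map_linear_functional {μ ν : Measure (ℝ × ℝ)} [IsFiniteMeasure μ] [IsFiniteMeasure ν]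
    (h : ∀ u v : ℝ, μ.map (fun p => u * p.1 + v * p.2) = ν.map (fun p => u * p.1 + v * p.2)) :
    μ = ν := by
  refine Measure.ext_of_charFunDual (funext fun L => ?_)
  have hL : ⇑L = fun p : ℝ × ℝ => L (1, 0) * p.1 + L (0, 1) * p.2 := by
    ext ⟨x, y⟩
    have : ((x, y) : ℝ × ℝ) = x • (1, 0) + y • (0, 1) := by simp
    rw [this, map_add, map_smul, map_smul]
    simp [mul_comm]
  rw [charFunDual_eq_charFun_map_one, charFunDual_eq_charFun_map_one, hL, h]

lemma measurable_expectPair (A B : Matrix (Fin 2) (Fin 2) ℂ) : Measurable (expectPair A B) :=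
  (measurable_expect A).prodMk (measurable_expect B)

lemma map_linear_functional_expectPair (a b : EuclideanSpace ℝ (Fin 3)) (u v : ℝ) :
    (haarState.map (expectPair (observable 0 a) (observable 0 b))).map
      (fun p => u * p.1 + v * p.2) = uniformIcc.map (fun x => ‖u • a + v • b‖ * x) := by
  rw [Measure.map_map (by fun_prop) (measurable_expectPair _ _), ← map_expect_observable_zero]
  congr 1
  ext ψ
  exact (expect_observable_smul_add_smul a b u v ψ).symm

lemma map_expectPair_eq_map_add (a₀ b₀ : ℝ) (a b : EuclideanSpace ℝ (Fin 3)) :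
    haarState.map (expectPair (observable a₀ a) (observable b₀ b)) =
      (haarState.map (expectPair (observable 0 a) (observable 0 b))).map
        (fun p => (a₀ + p.1, b₀ + p.2)) := by
  rw [Measure.map_map (by fun_prop) (measurable_expectPair _ _)]
  congr 1
  ext ψ
  · exact expect_observable a₀ a ψ
  · exact expect_observable b₀ b ψ

instance (A B : Matrix (Fin 2) (Fin 2) ℂ) : IsProbabilityMeasure (haarState.map (expectPair A B)) :=
  Measure.isProbabilityMeasure_map (measurable_expectPair A B).aemeasurable

/-- The law of the pair of expectation values is symmetric about `(a₀, b₀)`. -/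
lemma map_reflect_map_expectPair (a₀ b₀ : ℝ) (a b : EuclideanSpace ℝ (Fin 3)) :
    (haarState.map (expectPair (observable a₀ a) (observable b₀ b))).map
      (fun p => (2 * a₀ - p.1, 2 * b₀ - p.2)) =
      haarState.map (expectPair (observable a₀ a) (observable b₀ b)) := by
  obtain ⟨N, hN⟩ : ∃ N, N = haarState.map (expectPair (observable 0 a) (observable 0 b)) := ⟨_, rfl⟩
  have : IsProbabilityMeasure N := by rw [hN]; infer_instance
  have : IsProbabilityMeasure (N.map (fun p => (-p.1, -p.2))) :=
    Measure.isProbabilityMeasure_map (by fun_prop)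
  have hsymm : N.map (fun p => (-p.1, -p.2)) = N := by
    refine ext_of_map_linear_functional fun u v => ?_
    have h1 : (fun p : ℝ × ℝ => u * p.1 + v * p.2) ∘ (fun p : ℝ × ℝ => (-p.1, -p.2)) =
        fun p => (-u) * p.1 + (-v) * p.2 := by
      ext p; simp
    have h2 : ‖(-u) • a + (-v) • b‖ = ‖u • a + v • b‖ := by
      rw [← norm_neg]; congr 1; module
    rw [Measure.map_map (by fun_prop) (by fun_prop), h1]
    rw [hN, map_linear_functional_expectPair,
      map_linear_functional_expectPair, h2]
  rw [map_expectPair_eq_map_add, ← hN]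
  conv_rhs => rw [← hsymm]
  have hfun : (fun p : ℝ × ℝ => (2 * a₀ - p.1, 2 * b₀ - p.2)) ∘
      (fun p : ℝ × ℝ => (a₀ + p.1, b₀ + p.2)) =
      (fun p : ℝ × ℝ => (a₀ + p.1, b₀ + p.2)) ∘ (fun p : ℝ × ℝ => (-p.1, -p.2)) := by
    ext p <;> simp only [Function.comp_apply] <;> ring
  rw [Measure.map_map (by fun_prop) (by fun_prop), Measure.map_map (by fun_prop) (by fun_prop),
    hfun]

/-! ### The disk density -/

/-- The density of the orthogonal projection to a plane of the uniform measure on the unit sphere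
of `ℝ³`. -/
noncomputable def diskDensity (p : ℝ × ℝ) : ℝ≥0∞ :=
  ENNReal.ofReal (heaviside (1 - Real.sqrt (p.1 ^ 2 + p.2 ^ 2)) /
    (2 * Real.pi * Real.sqrt (1 - (p.1 ^ 2 + p.2 ^ 2))))

lemma measurable_heaviside : Measurable heaviside :=
  Measurable.ite measurableSet_Ioi measurable_const measurable_const

lemma measurable_diskDensity : Measurable diskDensity := by
  have := measurable_heaviside
  unfold diskDensity
  fun_prop

lemma lintegral_inv_sqrt_sq_sub_sq {c : ℝ} (hc : 0 < c) :
    ∫⁻ y in Set.Ioo (-c) c, ENNReal.ofReal (1 / Real.sqrt (c ^ 2 - y ^ 2)) =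
      ENNReal.ofReal Real.pi := by
  have hd : ∀ y ∈ Set.Ioo (-c) c,
      HasDerivAt (fun y => Real.arcsin (y / c)) (1 / Real.sqrt (c ^ 2 - y ^ 2)) y := by
    intro y hy
    have h1 : y / c ≠ -1 := by
      rw [ne_eq, div_eq_iff hc.ne']; linarith [hy.1]
    have h2 : y / c ≠ 1 := by
      rw [ne_eq, div_eq_iff hc.ne']; linarith [hy.2]
    have h := (Real.hasDerivAt_arcsin h1 h2).comp y ((hasDerivAt_id y).div_const c)
    convert! h using 1
    have h3 : c ^ 2 - y ^ 2 = c ^ 2 * (1 - (y / c) ^ 2) := by field_simp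
    rw [h3, Real.sqrt_mul (sq_nonneg c), Real.sqrt_sq hc.le]
    field_simp
  have hcont : ContinuousOn (fun y => Real.arcsin (y / c)) (Set.Icc (-c) c) :=
    (Real.continuous_arcsin.comp (continuous_id.div_const c)).continuousOn
  have hint : IntegrableOn (fun y => 1 / Real.sqrt (c ^ 2 - y ^ 2)) (Set.Ioc (-c) c) :=
    intervalIntegral.integrableOn_deriv_of_nonneg hcont hd fun y _ => by positivity
  have hval := intervalIntegral.integral_eq_sub_of_hasDerivAt_of_le (by linarith) hcont hd
    ((intervalIntegrable_iff_integrableOn_Ioc_of_le (by linarith)).2 hint)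
  rw [← ofReal_integral_eq_lintegral_ofReal (hint.mono_set Set.Ioo_subset_Ioc_self)
    (Filter.Eventually.of_forall fun y => by positivity), ← integral_Ioc_eq_integral_Ioo,
    ← intervalIntegral.integral_of_le (by linarith), hval]
  congr 1
  rw [neg_div, div_self hc.ne', Real.arcsin_one, Real.arcsin_neg, Real.arcsin_one]
  ring

/-- The marginal of the disk density is uniform. -/
lemma lintegral_diskDensity (x : ℝ) :
    ∫⁻ y, diskDensity (x, y) =
      (Set.Ioo (-1 : ℝ) 1).indicator (fun _ => ENNReal.ofReal (1 / 2)) x := by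
  have hzero : ∀ y, 1 ≤ x ^ 2 + y ^ 2 → diskDensity (x, y) = 0 := by
    intro y hy
    have : ¬ (0 < 1 - Real.sqrt (x ^ 2 + y ^ 2)) := by
      rw [not_lt, sub_nonpos, Real.one_le_sqrt]; exact hy
    simp [diskDensity, heaviside, this]
  by_cases hx : x ∈ Set.Ioo (-1 : ℝ) 1
  · have hpos : 0 < 1 - x ^ 2 := by nlinarith [hx.1, hx.2]
    set c := Real.sqrt (1 - x ^ 2) with hc
    have hc0 : 0 < c := Real.sqrt_pos.2 hpos
    have hc2 : c ^ 2 = 1 - x ^ 2 := Real.sq_sqrt hpos.le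
    have h : ∀ y, diskDensity (x, y) = (Set.Ioo (-c) c).indicator
        (fun y => ENNReal.ofReal (1 / (2 * Real.pi)) *
          ENNReal.ofReal (1 / Real.sqrt (c ^ 2 - y ^ 2))) y := by
      intro y
      by_cases hy : y ∈ Set.Ioo (-c) c
      · have h1 : y ^ 2 < c ^ 2 := sq_lt_sq' hy.1 hy.2
        have h2 : 0 < 1 - Real.sqrt (x ^ 2 + y ^ 2) := by
          rw [sub_pos, Real.sqrt_lt' one_pos]; linarith
        rw [Set.indicator_of_mem hy, diskDensity, heaviside, if_pos h2,
          ← ENNReal.ofReal_mul (by positivity)]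
        congr 1
        have h3 : c ^ 2 - y ^ 2 = 1 - (x ^ 2 + y ^ 2) := by linarith
        rw [h3, div_mul_div_comm, one_mul]
      · rw [Set.indicator_of_notMem hy]
        apply hzero
        by_contra! hlt
        exact hy (abs_lt.1 (abs_lt_of_sq_lt_sq (by linarith) hc0.le))
    simp_rw [h]
    rw [lintegral_indicator measurableSet_Ioo, lintegral_const_mul _ (by fun_prop),
      lintegral_inv_sqrt_sq_sub_sq hc0, Set.indicator_of_mem hx,
      ← ENNReal.ofReal_mul (by positivity)]
    congr 1
    field_simp
  · rw [Set.indicator_of_notMem hx]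
    have : ∀ y, diskDensity (x, y) = 0 := fun y => by
      apply hzero
      have : 1 ≤ x ^ 2 := by
        by_contra! hlt
        exact hx (abs_lt.1 ((sq_lt_one_iff_abs_lt_one x).1 hlt))
      nlinarith [sq_nonneg y]
    simp [this]

lemma map_fst_withDensity_diskDensity :
    ((volume : Measure (ℝ × ℝ)).withDensity diskDensity).map Prod.fst = uniformIcc := by
  ext s hs
  have hind : ∀ p : ℝ × ℝ, (Prod.fst ⁻¹' s).indicator diskDensity p =
      s.indicator (fun _ => diskDensity p) p.1 := fun p => by
    by_cases h : p.1 ∈ s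
    · rw [Set.indicator_of_mem h, Set.indicator_of_mem (by exact h)]
    · rw [Set.indicator_of_notMem h, Set.indicator_of_notMem (by exact h)]
  rw [Measure.map_apply measurable_fst hs, withDensity_apply _ (measurable_fst hs),
    ← lintegral_indicator (measurable_fst hs), Measure.volume_eq_prod,
    lintegral_prod _ (measurable_diskDensity.indicator (measurable_fst hs)).aemeasurable]
  have : ∀ x : ℝ, ∫⁻ y, (Prod.fst ⁻¹' s).indicator diskDensity (x, y) =
      (s ∩ Set.Ioo (-1 : ℝ) 1).indicator (fun _ => ENNReal.ofReal (1 / 2)) x := by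
    intro x
    simp_rw [hind]
    rw [← Set.indicator_indicator]
    by_cases h : x ∈ s
    · simp only [Set.indicator_of_mem h, lintegral_diskDensity]
    · simp only [Set.indicator_of_notMem h, lintegral_zero]
  simp_rw [this]
  rw [lintegral_indicator (hs.inter measurableSet_Ioo), lintegral_const,
    Measure.restrict_apply_univ, uniformIcc, Measure.smul_apply, smul_eq_mul,
    ← Measure.restrict_congr_set Ioo_ae_eq_Icc, Measure.restrict_apply hs]

/-- Change of variables for a map that rescales Lebesgue measure. -/
lemma map_withDensity_const_mul_comp {e : ℝ × ℝ → ℝ × ℝ} (he : Measurable e) {c : ℝ≥0∞}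
    (hvol : (volume : Measure (ℝ × ℝ)).map e = c⁻¹ • volume) (hc0 : c ≠ 0) (hc : c ≠ ∞)
    {g : ℝ × ℝ → ℝ≥0∞} (hg : Measurable g) :
    ((volume : Measure (ℝ × ℝ)).withDensity (fun p => c * g (e p))).map e =
      volume.withDensity g := by
  ext s hs
  rw [Measure.map_apply he hs, withDensity_apply _ (he hs), withDensity_apply _ hs,
    lintegral_const_mul c (show Measurable fun p => g (e p) from hg.comp he),
    ← setLIntegral_map hs hg he, hvol,
    Measure.restrict_smul, lintegral_smul_measure, smul_eq_mul, ← mul_assoc,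
    ENNReal.mul_inv_cancel hc0 hc, one_mul]

lemma map_linear_volume {α β γ δ : ℝ} (h : 0 < α * δ - β * γ) :
    (volume : Measure (ℝ × ℝ)).map (fun p => (α * p.1 + β * p.2, γ * p.1 + δ * p.2)) =
      (ENNReal.ofReal (α * δ - β * γ))⁻¹ • volume := by
  have hdet : LinearMap.det (Matrix.toLin (Module.Basis.finTwoProd ℝ) (Module.Basis.finTwoProd ℝ)
      !![α, β; γ, δ]) = α * δ - β * γ := by
    rw [LinearMap.det_toLin, Matrix.det_fin_two_of]
  have hfun : (fun p : ℝ × ℝ => (α * p.1 + β * p.2, γ * p.1 + δ * p.2)) =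
      Matrix.toLin (Module.Basis.finTwoProd ℝ) (Module.Basis.finTwoProd ℝ) !![α, β; γ, δ] := by
    ext p <;> simp [Matrix.toLin_finTwoProd_apply]
  rw [hfun, Measure.map_linearMap_addHaar_eq_smul_addHaar _ (by rw [hdet]; exact h.ne'), hdet,
    abs_of_pos (inv_pos.2 h), ENNReal.ofReal_inv_of_pos h]

/-- By rotational symmetry, every one-dimensional projection of the disk density is uniform. -/
lemma map_linear_functional_diskDensity (u v : ℝ) :
    ((volume : Measure (ℝ × ℝ)).withDensity diskDensity).map (fun p => u * p.1 + v * p.2) =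
      uniformIcc.map (fun x => Real.sqrt (u ^ 2 + v ^ 2) * x) := by
  obtain ⟨r, hr⟩ : ∃ r, r = Real.sqrt (u ^ 2 + v ^ 2) := ⟨_, rfl⟩
  rw [← hr]
  -- for `u = v = 0` the radius is `0`, and any unit vector `(c, s)` will do
  obtain ⟨c, s, hcs, hu, hv⟩ : ∃ c s : ℝ, c ^ 2 + s ^ 2 = 1 ∧ r * c = u ∧ r * s = v := by
    have hr2 : r ^ 2 = u ^ 2 + v ^ 2 := by rw [hr, Real.sq_sqrt (by positivity)]
    rcases (Real.sqrt_nonneg (u ^ 2 + v ^ 2)).eq_or_lt with h | h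
    · rw [← hr] at h
      rw [← h] at hr2
      exact ⟨1, 0, by norm_num, by rw [← h]; nlinarith, by rw [← h]; nlinarith⟩
    · rw [← hr] at h
      refine ⟨u / r, v / r, ?_, by field_simp, by field_simp⟩
      rw [div_pow, div_pow, ← add_div, ← hr2, div_self (by positivity)]
  have h1 : 0 < c * c - s * (-s) := by nlinarith
  have hrot : ((volume : Measure (ℝ × ℝ)).withDensity diskDensity).map
      (fun p => (c * p.1 + s * p.2, -s * p.1 + c * p.2)) = volume.withDensity diskDensity := by
    have h2 : c * c - s * (-s) = 1 := by linarith
    have h := map_withDensity_const_mul_comp (by fun_prop) (map_linear_volume h1)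
      (by simpa using h1) ENNReal.ofReal_ne_top measurable_diskDensity
    rw [h2, ENNReal.ofReal_one] at h
    conv_rhs => rw [← h]
    congr 2
    ext p
    have h3 : (c * p.1 + s * p.2) ^ 2 + (-s * p.1 + c * p.2) ^ 2 = p.1 ^ 2 + p.2 ^ 2 := by
      linear_combination (p.1 ^ 2 + p.2 ^ 2) * hcs
    simp only [diskDensity, h3, one_mul]
  rw [← map_fst_withDensity_diskDensity]
  conv_rhs => rw [← hrot]
  rw [Measure.map_map (by fun_prop) (by fun_prop), Measure.map_map (by fun_prop) (by fun_prop)]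
  congr 1
  ext p
  simp only [Function.comp_apply, ← hu, ← hv]
  ring

/-! ### The joint density of the expectation values -/

lemma det_gramMatrix (a b : EuclideanSpace ℝ (Fin 3)) :
    (gramMatrix a b).det = ‖a‖ ^ 2 * ‖b‖ ^ 2 - inner ℝ a b ^ 2 := by
  rw [gramMatrix, Matrix.det_fin_two_of, real_inner_self_eq_norm_sq, real_inner_self_eq_norm_sq,
    real_inner_comm a b, sq (inner ℝ _ _)]

lemma det_gramMatrix_pos {a b : EuclideanSpace ℝ (Fin 3)} (ha : a ≠ 0)
    (h : LinearIndependent ℝ ![a, b]) : 0 < (gramMatrix a b).det := by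
  have hne : ‖a‖ ^ 2 • b - inner ℝ a b • a ≠ 0 := by
    intro h0
    have := LinearIndependent.pair_iff.1 h (-inner ℝ a b) (‖a‖ ^ 2) (by rw [← h0]; module)
    exact ha (by simpa using this.2)
  have hpos : 0 < ‖‖a‖ ^ 2 • b - inner ℝ a b • a‖ ^ 2 := by positivity
  have heq : ‖‖a‖ ^ 2 • b - inner ℝ a b • a‖ ^ 2 = ‖a‖ ^ 2 * (gramMatrix a b).det := by
    rw [det_gramMatrix, norm_sub_sq_real, norm_smul, norm_smul, inner_smul_left, inner_smul_right,
      real_inner_comm]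
    simp only [Real.norm_eq_abs, mul_pow, sq_abs, conj_trivial]
    ring
  rw [heq] at hpos
  exact pos_of_mul_pos_right hpos (by positivity)

lemma omega_eq (a₀ b₀ : ℝ) {a b : EuclideanSpace ℝ (Fin 3)} (p : ℝ × ℝ) :
    omega a₀ b₀ a b p = Real.sqrt ((‖b‖ ^ 2 * (p.1 - a₀) ^ 2 -
      2 * inner ℝ a b * (p.1 - a₀) * (p.2 - b₀) + ‖a‖ ^ 2 * (p.2 - b₀) ^ 2) /
        (gramMatrix a b).det) := by
  rw [omega, Matrix.inv_def, Ring.inverse_eq_inv']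
  congr 1
  rw [div_eq_inv_mul]
  generalize (gramMatrix a b).det = d
  simp [gramMatrix, Matrix.adjugate_fin_two_of, real_inner_comm b a,
    Matrix.mulVec, dotProduct, Fin.sum_univ_two]
  ring

lemma measurable_expectDensity (a₀ b₀ : ℝ) (a b : EuclideanSpace ℝ (Fin 3)) :
    Measurable (expectDensity a₀ b₀ a b) := by
  have := measurable_heaviside
  have h2 : Measurable (omega a₀ b₀ a b) := by
    simp only [funext (omega_eq a₀ b₀ (a := a) (b := b))]
    fun_prop
  unfold expectDensity
  fun_prop

/-- The law of the pair of expectation values of two observables with linearly independent Bloch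
vectors. The Cholesky factor of the Gram matrix carries the disk density to it. -/
lemma map_expectPair_eq_withDensity (a₀ b₀ : ℝ) {a b : EuclideanSpace ℝ (Fin 3)} (ha : a ≠ 0)
    (h : LinearIndependent ℝ ![a, b]) :
    haarState.map (expectPair (observable a₀ a) (observable b₀ b)) =
      volume.withDensity (expectDensity a₀ b₀ a b) := by
  have hdet := det_gramMatrix_pos ha h
  have hdet' := det_gramMatrix a b
  set Δ := (gramMatrix a b).det with hΔ
  have hα : 0 < ‖a‖ := norm_pos_iff.2 ha
  set α := ‖a‖ with hα'
  -- `(x, y) ↦ (α x, β x + γ y)` is the Cholesky factor of the Gram matrix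
  set β := inner ℝ a b / α with hβ
  set γ := Real.sqrt Δ / α with hγ
  have hsq : Real.sqrt Δ ^ 2 = Δ := Real.sq_sqrt hdet.le
  have hγ2 : α ^ 2 * γ ^ 2 = Δ := by rw [hγ, div_pow, hsq]; field_simp
  have hαβ : inner ℝ a b = α * β := by rw [hβ]; field_simp
  have hαγ : α * γ - 0 * β = Real.sqrt Δ := by rw [hγ]; field_simp; ring
  have hpos : 0 < α * γ - 0 * β := by rw [hαγ]; exact Real.sqrt_pos.2 hdet
  have hb2 : ‖b‖ ^ 2 = β ^ 2 + γ ^ 2 := by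
    have : α ^ 2 * ‖b‖ ^ 2 = α ^ 2 * (β ^ 2 + γ ^ 2) := by
      rw [hαβ] at hdet'; linear_combination -hdet' - hγ2
    exact mul_left_cancel₀ (by positivity) this
  have hD : IsProbabilityMeasure ((volume : Measure (ℝ × ℝ)).withDensity diskDensity) := by
    refine ⟨?_⟩
    have h1 := congrArg (fun μ => μ Set.univ) map_fst_withDensity_diskDensity
    simpa [Measure.map_apply measurable_fst MeasurableSet.univ] using h1
  have hprob : IsProbabilityMeasure (((volume : Measure (ℝ × ℝ)).withDensity diskDensity).map
      (fun p => (α * p.1 + 0 * p.2, β * p.1 + γ * p.2))) :=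
    Measure.isProbabilityMeasure_map (by fun_prop)
  have h0 : haarState.map (expectPair (observable 0 a) (observable 0 b)) =
      ((volume : Measure (ℝ × ℝ)).withDensity diskDensity).map
        (fun p => (α * p.1 + 0 * p.2, β * p.1 + γ * p.2)) := by
    refine ext_of_map_linear_functional fun u v => ?_
    have hfun : (fun p : ℝ × ℝ => u * p.1 + v * p.2) ∘
        (fun p : ℝ × ℝ => (α * p.1 + 0 * p.2, β * p.1 + γ * p.2)) =
        fun p => (u * α + v * β) * p.1 + (v * γ) * p.2 := by
      ext p; simp only [Function.comp_apply]; ring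
    have hnorm : ‖u • a + v • b‖ = Real.sqrt ((u * α + v * β) ^ 2 + (v * γ) ^ 2) := by
      rw [← Real.sqrt_sq (norm_nonneg (u • a + v • b)), norm_add_sq_real, norm_smul, norm_smul,
        inner_smul_left, inner_smul_right, mul_pow, mul_pow, hb2, hαβ, ← hα']
      congr 1
      simp only [Real.norm_eq_abs, sq_abs, conj_trivial]
      ring
    rw [map_linear_functional_expectPair, Measure.map_map (by fun_prop) (by fun_prop), hfun,
      map_linear_functional_diskDensity, hnorm]
  have hvol : (volume : Measure (ℝ × ℝ)).map ((fun p => (a₀ + p.1, b₀ + p.2)) ∘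
      (fun p => (α * p.1 + 0 * p.2, β * p.1 + γ * p.2))) =
      (ENNReal.ofReal (α * γ - 0 * β))⁻¹ • volume := by
    rw [← Measure.map_map (by fun_prop) (by fun_prop), map_linear_volume hpos, Measure.map_smul]
    congr 1
    exact (measurePreserving_add_left volume ((a₀, b₀) : ℝ × ℝ)).map_eq
  rw [map_expectPair_eq_map_add, h0, Measure.map_map (by fun_prop) (by fun_prop),
    ← map_withDensity_const_mul_comp (by fun_prop) hvol (by simpa using hpos)
      ENNReal.ofReal_ne_top (measurable_expectDensity a₀ b₀ a b)]
  congr 2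
  ext p
  have hω : omega a₀ b₀ a b (((fun p => (a₀ + p.1, b₀ + p.2)) ∘
      (fun p : ℝ × ℝ => (α * p.1 + 0 * p.2, β * p.1 + γ * p.2))) p) =
      Real.sqrt (p.1 ^ 2 + p.2 ^ 2) := by
    rw [omega_eq, ← hΔ]
    congr 1
    rw [div_eq_iff hdet.ne', ← hγ2, hb2, hαβ, ← hα']
    simp only [Function.comp_apply]
    ring
  rw [expectDensity, hω, diskDensity, ← ENNReal.ofReal_mul hpos.le, Real.sq_sqrt (by positivity),
    hαγ, Real.sqrt_mul hdet.le]
  congr 1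
  have : Real.sqrt Δ ≠ 0 := (Real.sqrt_pos.2 hdet).ne'
  rw [mul_div_assoc', mul_left_comm, mul_div_mul_left _ _ this]

/-! ### Composition of a measure with a local diffeomorphism -/

/-- Where `F` is a left inverse of `φ`, composing with `φ` is, up to the Jacobian, pushing the
restriction to the image of `φ` forward along `F`. -/
lemma map_comap_restrict_eq {U : Set (ℝ × ℝ)} {φ F : ℝ × ℝ → ℝ × ℝ} (hU : MeasurableSet U)
    (hφ : ContinuousOn φ U) (hF : Measurable F) (h : Set.LeftInvOn F φ U) (ν : Measure (ℝ × ℝ)) :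
    (ν.comap (fun p : U => φ p)).map Subtype.val = (ν.restrict (φ '' U)).map F := by
  have hemb : MeasurableEmbedding (fun p : U => φ p) := hφ.measurableEmbedding hU h.injOn
  ext s hs
  rw [Measure.map_apply measurable_subtype_coe hs, hemb.comap_apply, Measure.map_apply hF hs,
    Measure.restrict_apply (hF hs)]
  congr 1
  ext q
  constructor
  · rintro ⟨p, hp, rfl⟩
    refine ⟨?_, p, p.2, rfl⟩
    simpa only [Set.mem_preimage, h p.2] using hp
  · rintro ⟨hq, p, hp, rfl⟩
    refine ⟨⟨p, hp⟩, ?_, rfl⟩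
    simpa only [Set.mem_preimage, h hp] using hq

/-- The composite before division by the Jacobian, for a measure with a density: the change of
variables formula. -/
lemma map_comap_withDensity {U : Set (ℝ × ℝ)} {φ : ℝ × ℝ → ℝ × ℝ} (hU : MeasurableSet U)
    (hφ : ∀ p ∈ U, DifferentiableAt ℝ φ p) (h : Set.InjOn φ U) (f : ℝ × ℝ → ℝ≥0∞) :
    ((volume.withDensity f).comap (fun p : U => φ p)).map Subtype.val =
      (volume.restrict U).withDensity
        (fun p => ENNReal.ofReal |(fderiv ℝ φ p).det| * f (φ p)) := by
  have hcont : ContinuousOn φ U := fun p hp => (hφ p hp).continuousAt.continuousWithinAt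
  have hemb : MeasurableEmbedding (fun p : U => φ p) := hcont.measurableEmbedding hU h
  ext s hs
  have hsU := hs.inter hU
  have himg : (fun p : U => φ p) '' (Subtype.val ⁻¹' s) = φ '' (s ∩ U) := by
    ext q
    constructor
    · rintro ⟨p, hp, rfl⟩; exact ⟨p, ⟨hp, p.2⟩, rfl⟩
    · rintro ⟨p, ⟨hp, hpU⟩, rfl⟩; exact ⟨⟨p, hpU⟩, hp, rfl⟩
  have hmeas : MeasurableSet (φ '' (s ∩ U)) := by
    rw [← himg]; exact hemb.measurableSet_image.2 (measurable_subtype_coe hs)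
  rw [Measure.map_apply measurable_subtype_coe hs, hemb.comap_apply, himg,
    withDensity_apply _ hmeas, withDensity_apply _ hs, Measure.restrict_restrict hs,
    lintegral_image_eq_lintegral_abs_det_fderiv_mul volume hsU
      (fun p hp => (hφ p hp.2).hasFDerivAt.hasFDerivWithinAt) (h.mono Set.inter_subset_right)]

lemma measurable_abs_det_fderiv_inv (φ : ℝ × ℝ → ℝ × ℝ) :
    Measurable fun p => ENNReal.ofReal (|(fderiv ℝ φ p).det|⁻¹) := by
  have h : Measurable fun p => (fderiv ℝ φ p).det :=
    ContinuousLinearMap.continuous_det.measurable.comp (measurable_fderiv ℝ φ)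
  fun_prop

/-- For a measure with density `f`, the composite with `φ` has density `f ∘ φ` on `U`. -/
lemma genComp_withDensity {U : Set (ℝ × ℝ)} {φ : ℝ × ℝ → ℝ × ℝ} (hU : MeasurableSet U)
    (hφm : Measurable φ) (hφ : ∀ p ∈ U, DifferentiableAt ℝ φ p) (h : Set.InjOn φ U)
    (hdet : ∀ p ∈ U, (fderiv ℝ φ p).det ≠ 0) {f : ℝ × ℝ → ℝ≥0∞} (hf : Measurable f) :
    genComp U φ (volume.withDensity f) = (volume.restrict U).withDensity (fun p => f (φ p)) := by
  have hm : Measurable fun p => (fderiv ℝ φ p).det :=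
    ContinuousLinearMap.continuous_det.measurable.comp (measurable_fderiv ℝ φ)
  rw [genComp, map_comap_withDensity hU hφ h, ← withDensity_mul _ (by fun_prop) (by fun_prop)]
  refine withDensity_congr_ae ((ae_restrict_iff' hU).2 (Filter.Eventually.of_forall fun p hp => ?_))
  have hpos : 0 < |(fderiv ℝ φ p).det| := abs_pos.2 (hdet p hp)
  simp only [Pi.mul_apply]
  rw [mul_right_comm, ← ENNReal.ofReal_mul hpos.le, mul_inv_cancel₀ hpos.ne', ENNReal.ofReal_one,
    one_mul]

lemma differentiableAt_and_det_fderiv_prodMap {g h : ℝ → ℝ} {g' h' : ℝ} {p : ℝ × ℝ}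
    (hg : HasDerivAt g g' p.1) (hh : HasDerivAt h h' p.2) :
    DifferentiableAt ℝ (fun p : ℝ × ℝ => (g p.1, h p.2)) p ∧
      (fderiv ℝ (fun p : ℝ × ℝ => (g p.1, h p.2)) p).det = g' * h' := by
  have H : HasFDerivAt (fun p : ℝ × ℝ => (g p.1, h p.2)) _ p :=
    HasFDerivAt.prodMap p hg.hasFDerivAt hh.hasFDerivAt
  refine ⟨H.differentiableAt, ?_⟩
  rw [H.fderiv, ContinuousLinearMap.det, ContinuousLinearMap.coe_prodMap, LinearMap.det_prodMap]
  simp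

/-! ### The branches of the inverse of the map from expectation values to uncertainties -/

lemma sqrt_sq_sub_sq_pos {ℓ x : ℝ} (hx : x ∈ Set.Ioo 0 ℓ) : 0 < Real.sqrt (ℓ ^ 2 - x ^ 2) :=
  Real.sqrt_pos.2 (by nlinarith [hx.1, hx.2])

lemma sqrt_sq_sub_sq_mem {ℓ x : ℝ} (hx : x ∈ Set.Ioo 0 ℓ) :
    Real.sqrt (ℓ ^ 2 - x ^ 2) ∈ Set.Ioo 0 ℓ :=
  ⟨sqrt_sq_sub_sq_pos hx, (Real.sqrt_lt' (hx.1.trans hx.2)).2 (by nlinarith [hx.1])⟩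

lemma sqrt_sq_sub_sqrt_sq {ℓ x : ℝ} (hx : x ∈ Set.Ioo 0 ℓ) :
    Real.sqrt (ℓ ^ 2 - Real.sqrt (ℓ ^ 2 - x ^ 2) ^ 2) = x := by
  rw [Real.sq_sqrt (by nlinarith [hx.1, hx.2]), sub_sub_cancel, Real.sqrt_sq hx.1.le]

lemma hasDerivAt_sqrt_sq_sub_sq {ℓ x : ℝ} (hx : x ∈ Set.Ioo 0 ℓ) :
    HasDerivAt (fun x => Real.sqrt (ℓ ^ 2 - x ^ 2)) (-x / Real.sqrt (ℓ ^ 2 - x ^ 2)) x := by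
  have h0 : ℓ ^ 2 - x ^ 2 ≠ 0 := by nlinarith [hx.1, hx.2]
  have h := ((hasDerivAt_pow 2 x).const_sub (ℓ ^ 2)).sqrt h0
  convert h using 1
  have := (sqrt_sq_sub_sq_pos hx).ne'
  push_cast
  field_simp

lemma hasDerivAt_rootPlus (c₀ : ℝ) {ℓ x : ℝ} (hx : x ∈ Set.Ioo 0 ℓ) :
    HasDerivAt (rootPlus c₀ ℓ) (-x / Real.sqrt (ℓ ^ 2 - x ^ 2)) x :=
  (hasDerivAt_sqrt_sq_sub_sq hx).const_add c₀

lemma hasDerivAt_rootMinus (c₀ : ℝ) {ℓ x : ℝ} (hx : x ∈ Set.Ioo 0 ℓ) :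
    HasDerivAt (rootMinus c₀ ℓ) (x / Real.sqrt (ℓ ^ 2 - x ^ 2)) x := by
  have h := (hasDerivAt_sqrt_sq_sub_sq hx).const_sub c₀
  rwa [neg_div, neg_neg] at h

/-- The standard deviation of an observable as a function of its expectation value. -/
noncomputable def deviation (c₀ ℓ r : ℝ) : ℝ := Real.sqrt (ℓ ^ 2 - (r - c₀) ^ 2)

lemma deviation_rootPlus (c₀ : ℝ) {ℓ x : ℝ} (hx : x ∈ Set.Ioo 0 ℓ) :
    deviation c₀ ℓ (rootPlus c₀ ℓ x) = x := by
  rw [deviation, rootPlus, add_sub_cancel_left, sqrt_sq_sub_sqrt_sq hx]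

lemma deviation_rootMinus (c₀ : ℝ) {ℓ x : ℝ} (hx : x ∈ Set.Ioo 0 ℓ) :
    deviation c₀ ℓ (rootMinus c₀ ℓ x) = x := by
  rw [deviation, rootMinus, sub_sub_cancel_left, neg_sq, sqrt_sq_sub_sqrt_sq hx]

lemma image_rootPlus (c₀ ℓ : ℝ) : rootPlus c₀ ℓ '' Set.Ioo 0 ℓ = Set.Ioo c₀ (c₀ + ℓ) := by
  ext r
  constructor
  · rintro ⟨x, hx, rfl⟩
    have := sqrt_sq_sub_sq_mem hx
    exact ⟨by rw [rootPlus]; linarith [this.1], by rw [rootPlus]; linarith [this.2]⟩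
  · rintro ⟨h1, h2⟩
    have h : r - c₀ ∈ Set.Ioo 0 ℓ := ⟨by linarith, by linarith⟩
    exact ⟨_, sqrt_sq_sub_sq_mem h, by rw [rootPlus, sqrt_sq_sub_sqrt_sq h]; ring⟩

lemma image_rootMinus (c₀ ℓ : ℝ) : rootMinus c₀ ℓ '' Set.Ioo 0 ℓ = Set.Ioo (c₀ - ℓ) c₀ := by
  ext r
  constructor
  · rintro ⟨x, hx, rfl⟩
    have := sqrt_sq_sub_sq_mem hx
    exact ⟨by rw [rootMinus]; linarith [this.2], by rw [rootMinus]; linarith [this.1]⟩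
  · rintro ⟨h1, h2⟩
    have h : c₀ - r ∈ Set.Ioo 0 ℓ := ⟨by linarith, by linarith⟩
    exact ⟨_, sqrt_sq_sub_sq_mem h, by rw [rootMinus, sqrt_sq_sub_sqrt_sq h]; ring⟩

lemma measurable_rootPlus (c₀ ℓ : ℝ) : Measurable (rootPlus c₀ ℓ) := by
  unfold rootPlus; fun_prop

lemma measurable_rootMinus (c₀ ℓ : ℝ) : Measurable (rootMinus c₀ ℓ) := by
  unfold rootMinus; fun_prop

lemma measurable_weight (ℓ m : ℝ) : Measurable (weight ℓ m) := by
  unfold weight; fun_prop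

lemma measurable_deviation (c₀ ℓ : ℝ) : Measurable (deviation c₀ ℓ) := by
  unfold deviation; fun_prop

/-- The weight is twice the modulus of the Jacobian of either branch of the inverse. -/
lemma weight_eq_two_mul_jacobian {ℓ m : ℝ} {p : ℝ × ℝ} (hp : p ∈ Set.Ioo 0 ℓ ×ˢ Set.Ioo 0 m)
    {J : ℝ} (hJ : |J| = p.1 / Real.sqrt (ℓ ^ 2 - p.1 ^ 2) * (p.2 / Real.sqrt (m ^ 2 - p.2 ^ 2))) :
    J ≠ 0 ∧ ENNReal.ofReal (|J|⁻¹) * weight ℓ m p = 2 := by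
  have h1 := sqrt_sq_sub_sq_pos hp.1
  have h2 := sqrt_sq_sub_sq_pos hp.2
  have hx := hp.1.1
  have hy := hp.2.1
  have hpos : 0 < |J| := by rw [hJ]; positivity
  refine ⟨abs_pos.1 hpos, ?_⟩
  rw [weight, ← ENNReal.ofReal_mul (by positivity), hJ,
    Real.sqrt_mul (Real.sqrt_pos.1 h1).le]
  rw [← ENNReal.ofReal_ofNat 2]
  congr 1
  field_simp

/-- `φ` is the branch, on `(0, ℓ) × (0, m)`, of the inverse of the map that takes expectation values
to standard deviations, with image `(a₀, a₀ + ℓ) × V`; the modulus of its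
Jacobian is half the weight. -/
structure IsInverseBranch (a₀ b₀ ℓ m : ℝ) (V : Set ℝ) (φ : ℝ × ℝ → ℝ × ℝ) : Prop where
  measurable : Measurable φ
  differentiableAt : ∀ p ∈ Set.Ioo 0 ℓ ×ˢ Set.Ioo 0 m, DifferentiableAt ℝ φ p
  leftInvOn : Set.LeftInvOn (Prod.map (deviation a₀ ℓ) (deviation b₀ m)) φ
    (Set.Ioo 0 ℓ ×ˢ Set.Ioo 0 m)
  image_eq : φ '' (Set.Ioo 0 ℓ ×ˢ Set.Ioo 0 m) = Set.Ioo a₀ (a₀ + ℓ) ×ˢ V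
  det_ne_zero : ∀ p ∈ Set.Ioo 0 ℓ ×ˢ Set.Ioo 0 m, (fderiv ℝ φ p).det ≠ 0
  inv_det_mul_weight : ∀ p ∈ Set.Ioo 0 ℓ ×ˢ Set.Ioo 0 m,
    ENNReal.ofReal (|(fderiv ℝ φ p).det|⁻¹) * weight ℓ m p = 2

lemma isInverseBranch_rootPlus (a₀ b₀ ℓ m : ℝ) :
    IsInverseBranch a₀ b₀ ℓ m (Set.Ioo b₀ (b₀ + m))
      (fun p => (rootPlus a₀ ℓ p.1, rootPlus b₀ m p.2)) := by
  have hd := fun (p : ℝ × ℝ) (hp : p ∈ Set.Ioo 0 ℓ ×ˢ Set.Ioo 0 m) =>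
    differentiableAt_and_det_fderiv_prodMap (hasDerivAt_rootPlus a₀ hp.1)
      (hasDerivAt_rootPlus b₀ hp.2)
  have hJ := fun (p : ℝ × ℝ) (hp : p ∈ Set.Ioo 0 ℓ ×ˢ Set.Ioo 0 m) =>
    weight_eq_two_mul_jacobian hp
      (J := (fderiv ℝ (fun p : ℝ × ℝ => (rootPlus a₀ ℓ p.1, rootPlus b₀ m p.2)) p).det) (by
        rw [(hd p hp).2, abs_mul, abs_div, abs_div, abs_neg, abs_neg, abs_of_pos hp.1.1,
          abs_of_pos hp.2.1, abs_of_pos (sqrt_sq_sub_sq_pos hp.1),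
          abs_of_pos (sqrt_sq_sub_sq_pos hp.2)])
  exact
    { measurable := ((measurable_rootPlus _ _).comp measurable_fst).prodMk
        ((measurable_rootPlus _ _).comp measurable_snd)
      differentiableAt := fun p hp => (hd p hp).1
      leftInvOn := fun p hp =>
        Prod.ext (deviation_rootPlus a₀ hp.1) (deviation_rootPlus b₀ hp.2)
      image_eq := by
        rw [← image_rootPlus, ← image_rootPlus, ← Set.prodMap_image_prod]; rfl
      det_ne_zero := fun p hp => (hJ p hp).1
      inv_det_mul_weight := fun p hp => (hJ p hp).2 }

lemma isInverseBranch_rootMinus (a₀ b₀ ℓ m : ℝ) :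
    IsInverseBranch a₀ b₀ ℓ m (Set.Ioo (b₀ - m) b₀)
      (fun p => (rootPlus a₀ ℓ p.1, rootMinus b₀ m p.2)) := by
  have hd := fun (p : ℝ × ℝ) (hp : p ∈ Set.Ioo 0 ℓ ×ˢ Set.Ioo 0 m) =>
    differentiableAt_and_det_fderiv_prodMap (hasDerivAt_rootPlus a₀ hp.1)
      (hasDerivAt_rootMinus b₀ hp.2)
  have hJ := fun (p : ℝ × ℝ) (hp : p ∈ Set.Ioo 0 ℓ ×ˢ Set.Ioo 0 m) =>
    weight_eq_two_mul_jacobian hp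
      (J := (fderiv ℝ (fun p : ℝ × ℝ => (rootPlus a₀ ℓ p.1, rootMinus b₀ m p.2)) p).det) (by
        rw [(hd p hp).2, abs_mul, abs_div, abs_div, abs_neg, abs_of_pos hp.1.1,
          abs_of_pos hp.2.1, abs_of_pos (sqrt_sq_sub_sq_pos hp.1),
          abs_of_pos (sqrt_sq_sub_sq_pos hp.2)])
  exact
    { measurable := ((measurable_rootPlus _ _).comp measurable_fst).prodMk
        ((measurable_rootMinus _ _).comp measurable_snd)
      differentiableAt := fun p hp => (hd p hp).1
      leftInvOn := fun p hp =>
        Prod.ext (deviation_rootPlus a₀ hp.1) (deviation_rootMinus b₀ hp.2)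
      image_eq := by
        rw [← image_rootPlus, ← image_rootMinus, ← Set.prodMap_image_prod]; rfl
      det_ne_zero := fun p hp => (hJ p hp).1
      inv_det_mul_weight := fun p hp => (hJ p hp).2 }

/-- The weight cancels the Jacobian in the composite up to the factor `2`. What is left is the image
of the part of `ν` on one quadrant. -/
lemma IsInverseBranch.genComp_withDensity_weight {a₀ b₀ ℓ m : ℝ} {V : Set ℝ} {φ : ℝ × ℝ → ℝ × ℝ}
    (h : IsInverseBranch a₀ b₀ ℓ m V φ) (hV : MeasurableSet V) (ν : Measure (ℝ × ℝ)) :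
    (genComp (Set.Ioo 0 ℓ ×ˢ Set.Ioo 0 m) φ ν).withDensity (weight ℓ m) =
      (2 : ℝ≥0∞) • (ν.restrict (Set.Ioo a₀ (a₀ + ℓ) ×ˢ V)).map
        (Prod.map (deviation a₀ ℓ) (deviation b₀ m)) := by
  have hF : Measurable (Prod.map (deviation a₀ ℓ) (deviation b₀ m)) :=
    (measurable_deviation _ _).prodMap (measurable_deviation _ _)
  have hU : MeasurableSet (Set.Ioo 0 ℓ ×ˢ Set.Ioo 0 m) := measurableSet_Ioo.prod measurableSet_Ioo
  rw [genComp, ← withDensity_mul _ (measurable_abs_det_fderiv_inv φ) (measurable_weight _ _),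
    map_comap_restrict_eq hU
      (fun p hp => (h.differentiableAt p hp).continuousAt.continuousWithinAt) hF h.leftInvOn,
    h.image_eq, ← withDensity_const]
  refine withDensity_congr_ae ?_
  have hmem : ∀ᵐ p ∂(ν.restrict (Set.Ioo a₀ (a₀ + ℓ) ×ˢ V)).map
      (Prod.map (deviation a₀ ℓ) (deviation b₀ m)), p ∈ Set.Ioo 0 ℓ ×ˢ Set.Ioo 0 m := by
    rw [ae_map_iff (p := (· ∈ Set.Ioo 0 ℓ ×ˢ Set.Ioo 0 m)) hF.aemeasurable hU]
    refine (ae_restrict_iff' (measurableSet_Ioo.prod hV)).2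
      (Filter.Eventually.of_forall fun q hq => ?_)
    rw [← h.image_eq] at hq
    obtain ⟨p, hp, rfl⟩ := hq
    rwa [h.leftInvOn hp]
  filter_upwards [hmem] with p hp
  exact h.inv_det_mul_weight p hp

/-! ### The law of the uncertainties -/

lemma map_expect_observable (c₀ : ℝ) {c : EuclideanSpace ℝ (Fin 3)} (hc : c ≠ 0) :
    haarState.map (expect (observable c₀ c)) =
      ENNReal.ofReal (1 / (2 * ‖c‖)) • volume.restrict (Set.Icc (c₀ - ‖c‖) (c₀ + ‖c‖)) := by
  have hℓ : 0 < ‖c‖ := norm_pos_iff.2 hc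
  have hfun : expect (observable c₀ c) = (fun x => c₀ + x) ∘ expect (observable 0 c) := by
    ext ψ; exact expect_observable c₀ c ψ
  have hpre : (fun x => c₀ + ‖c‖ * x) ⁻¹' Set.Icc (c₀ - ‖c‖) (c₀ + ‖c‖) = Set.Icc (-1) 1 := by
    ext x
    simp only [Set.mem_preimage, Set.mem_Icc]
    constructor <;> rintro ⟨_, _⟩ <;> constructor <;> nlinarith
  have hvol : (volume : Measure ℝ).map (fun x => c₀ + ‖c‖ * x) =
      ENNReal.ofReal (‖c‖⁻¹) • volume := by
    have : (fun x => c₀ + ‖c‖ * x) = (fun x => c₀ + x) ∘ (fun x => ‖c‖ * x) := rfl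
    rw [this, ← Measure.map_map (by fun_prop) (by fun_prop), Real.map_volume_mul_left hℓ.ne',
      Measure.map_smul, map_add_left_eq_self, abs_of_pos (inv_pos.2 hℓ)]
  rw [hfun, ← Measure.map_map (by fun_prop) (measurable_expect _), map_expect_observable_zero,
    Measure.map_map (by fun_prop) (by fun_prop)]
  change uniformIcc.map (fun x => c₀ + ‖c‖ * x) = _
  rw [uniformIcc, ← hpre, Measure.map_smul, ← Measure.restrict_map (by fun_prop) measurableSet_Icc,
    hvol, Measure.restrict_smul, smul_smul, ← ENNReal.ofReal_mul (by norm_num)]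
  congr 2
  field_simp

/-- Almost surely the expectation value is neither the centre nor an end point of its range, where
the map from expectation values to standard deviations is not a local diffeomorphism. -/
lemma ae_expect_mem (c₀ : ℝ) {c : EuclideanSpace ℝ (Fin 3)} (hc : c ≠ 0) :
    ∀ᵐ ψ ∂haarState, expect (observable c₀ c) ψ ∈
      Set.Ioo c₀ (c₀ + ‖c‖) ∪ Set.Ioo (c₀ - ‖c‖) c₀ := by
  have hS : MeasurableSet (Set.Ioo c₀ (c₀ + ‖c‖) ∪ Set.Ioo (c₀ - ‖c‖) c₀) :=
    measurableSet_Ioo.union measurableSet_Ioo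
  refine (ae_map_iff (p := (· ∈ Set.Ioo c₀ (c₀ + ‖c‖) ∪ Set.Ioo (c₀ - ‖c‖) c₀))
    (measurable_expect _).aemeasurable hS).1 ?_
  rw [map_expect_observable c₀ hc]
  refine Measure.ae_smul_measure ?_ _
  rw [ae_restrict_iff' measurableSet_Icc]
  have hne : ∀ x : ℝ, ∀ᵐ r : ℝ, r ≠ x := fun x => by simp [ae_iff]
  filter_upwards [hne c₀, hne (c₀ + ‖c‖), hne (c₀ - ‖c‖)] with r h1 h2 h3 hr
  rcases lt_or_gt_of_ne h1 with h | h
  · exact Or.inr ⟨lt_of_le_of_ne hr.1 h3.symm, h⟩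
  · exact Or.inl ⟨h, lt_of_le_of_ne hr.2 h2⟩

/-- By the symmetry about `(a₀, b₀)`, the law of the standard deviations comes in equal parts from
the half-plane `r > a₀` and from its reflection `r < a₀`, hence twice from the two quadrants with
`r > a₀`. -/
lemma map_deviation_eq_two_smul (a₀ b₀ : ℝ) {a b : EuclideanSpace ℝ (Fin 3)} (ha : a ≠ 0)
    (hb : b ≠ 0) {N : Measure (ℝ × ℝ)}
    (hN : N = haarState.map (expectPair (observable a₀ a) (observable b₀ b))) :
    N.map (Prod.map (deviation a₀ ‖a‖) (deviation b₀ ‖b‖)) =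
      (2 : ℝ≥0∞) • (N.restrict (Set.Ioo a₀ (a₀ + ‖a‖) ×ˢ Set.Ioo b₀ (b₀ + ‖b‖))).map
          (Prod.map (deviation a₀ ‖a‖) (deviation b₀ ‖b‖)) +
        (2 : ℝ≥0∞) • (N.restrict (Set.Ioo a₀ (a₀ + ‖a‖) ×ˢ Set.Ioo (b₀ - ‖b‖) b₀)).map
          (Prod.map (deviation a₀ ‖a‖) (deviation b₀ ‖b‖)) := by
  set F := Prod.map (deviation a₀ ‖a‖) (deviation b₀ ‖b‖) with hFdef
  have hF : Measurable F := (measurable_deviation _ _).prodMap (measurable_deviation _ _)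
  set ρ : ℝ × ℝ → ℝ × ℝ := fun p => (2 * a₀ - p.1, 2 * b₀ - p.2) with hρ
  have hρm : Measurable ρ := by fun_prop
  have hρN : MeasurePreserving ρ N N :=
    ⟨hρm, by rw [hN]; exact map_reflect_map_expectPair a₀ b₀ a b⟩
  have hFρ : F ∘ ρ = F := by
    ext p <;> simp only [hFdef, hρ, Function.comp_apply, Prod.map_apply, deviation] <;>
      congr 1 <;> ring
  have hrefl : ∀ Q : Set (ℝ × ℝ), MeasurableSet Q →
      (N.restrict (ρ ⁻¹' Q)).map F = (N.restrict Q).map F := by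
    intro Q hQ
    rw [← (hρN.restrict_preimage hQ).map_eq, Measure.map_map hF hρm, hFρ]
  set Q₁ := Set.Ioo a₀ (a₀ + ‖a‖) ×ˢ Set.Ioo b₀ (b₀ + ‖b‖) with hQ₁
  set Q₂ := Set.Ioo a₀ (a₀ + ‖a‖) ×ˢ Set.Ioo (b₀ - ‖b‖) b₀ with hQ₂
  have m₁ : MeasurableSet Q₁ := measurableSet_Ioo.prod measurableSet_Ioo
  have m₂ : MeasurableSet Q₂ := measurableSet_Ioo.prod measurableSet_Ioo
  have hae : ∀ᵐ p ∂N, p ∈ (Q₁ ∪ Q₂) ∪ (ρ ⁻¹' Q₁ ∪ ρ ⁻¹' Q₂) := by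
    rw [hN, ae_map_iff (p := (· ∈ (Q₁ ∪ Q₂) ∪ (ρ ⁻¹' Q₁ ∪ ρ ⁻¹' Q₂)))
      (measurable_expectPair _ _).aemeasurable
      ((m₁.union m₂).union ((hρm m₁).union (hρm m₂)))]
    filter_upwards [ae_expect_mem a₀ ha, ae_expect_mem b₀ hb] with ψ h1 h2
    simp only [hQ₁, hQ₂, hρ, expectPair, Set.mem_union, Set.mem_preimage, Set.mem_prod,
      Set.mem_Ioo] at h1 h2 ⊢
    rcases h1 with ⟨h1, h1'⟩ | ⟨h1, h1'⟩ <;> rcases h2 with ⟨h2, h2'⟩ | ⟨h2, h2'⟩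
    · exact Or.inl (Or.inl ⟨⟨h1, h1'⟩, h2, h2'⟩)
    · exact Or.inl (Or.inr ⟨⟨h1, h1'⟩, h2, h2'⟩)
    · right; right; refine ⟨⟨?_, ?_⟩, ?_, ?_⟩ <;> linarith
    · right; left; refine ⟨⟨?_, ?_⟩, ?_, ?_⟩ <;> linarith
  have d₁ : Disjoint Q₁ Q₂ := Set.disjoint_left.2 fun p h h' => by
    linarith [h.2.1, h'.2.2]
  have d₂ : Disjoint (Q₁ ∪ Q₂) (ρ ⁻¹' Q₁ ∪ ρ ⁻¹' Q₂) := Set.disjoint_left.2 fun p h h' => by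
    have h1 : a₀ < p.1 := h.elim (fun h => h.1.1) (fun h => h.1.1)
    have h2 : a₀ < 2 * a₀ - p.1 := h'.elim (fun h => h.1.1) (fun h => h.1.1)
    linarith
  conv_lhs => rw [← Measure.restrict_eq_self_of_ae_mem hae,
    Measure.restrict_union d₂ ((hρm m₁).union (hρm m₂)), Measure.restrict_union d₁ m₂,
    Measure.restrict_union (d₁.preimage ρ) (hρm m₂), Measure.map_add _ _ hF,
    Measure.map_add _ _ hF, Measure.map_add _ _ hF, hrefl Q₁ m₁, hrefl Q₂ m₂]
  rw [two_smul, two_smul]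
  abel

lemma uncertaintyPair_observable (a₀ b₀ : ℝ) (a b : EuclideanSpace ℝ (Fin 3)) :
    uncertaintyPair (observable a₀ a) (observable b₀ b) =
      Prod.map (deviation a₀ ‖a‖) (deviation b₀ ‖b‖) ∘
        expectPair (observable a₀ a) (observable b₀ b) := by
  ext ψ
  · exact uncertainty_observable a₀ a ψ
  · exact uncertainty_observable b₀ b ψ

lemma map_uncertaintyPair (a₀ b₀ : ℝ) {a b : EuclideanSpace ℝ (Fin 3)} (ha : a ≠ 0) (hb : b ≠ 0) :
    haarState.map (uncertaintyPair (observable a₀ a) (observable b₀ b)) =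
      (genComp (Set.Ioo 0 ‖a‖ ×ˢ Set.Ioo 0 ‖b‖)
          (fun p => (rootPlus a₀ ‖a‖ p.1, rootPlus b₀ ‖b‖ p.2))
          (haarState.map (expectPair (observable a₀ a) (observable b₀ b))) +
        genComp (Set.Ioo 0 ‖a‖ ×ˢ Set.Ioo 0 ‖b‖)
          (fun p => (rootPlus a₀ ‖a‖ p.1, rootMinus b₀ ‖b‖ p.2))
          (haarState.map (expectPair (observable a₀ a) (observable b₀ b)))).withDensity
        (weight ‖a‖ ‖b‖) := by
  have hF : Measurable (Prod.map (deviation a₀ ‖a‖) (deviation b₀ ‖b‖)) :=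
    (measurable_deviation _ _).prodMap (measurable_deviation _ _)
  rw [withDensity_add_measure,
    (isInverseBranch_rootPlus a₀ b₀ ‖a‖ ‖b‖).genComp_withDensity_weight measurableSet_Ioo,
    (isInverseBranch_rootMinus a₀ b₀ ‖a‖ ‖b‖).genComp_withDensity_weight measurableSet_Ioo,
    ← map_deviation_eq_two_smul a₀ b₀ ha hb rfl, Measure.map_map hF (measurable_expectPair _ _),
    uncertaintyPair_observable]

lemma hasPDF_expectPair (a₀ b₀ : ℝ) {a b : EuclideanSpace ℝ (Fin 3)} (ha : a ≠ 0)
    (h : LinearIndependent ℝ ![a, b]) :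
    HasPDF (expectPair (observable a₀ a) (observable b₀ b)) haarState volume :=
  hasPDF_of_map_eq_withDensity (measurable_expectPair _ _).aemeasurable _
    (measurable_expectDensity a₀ b₀ a b).aemeasurable (map_expectPair_eq_withDensity a₀ b₀ ha h)

lemma map_uncertaintyPair_eq_withDensity (a₀ b₀ : ℝ) {a b : EuclideanSpace ℝ (Fin 3)} (ha : a ≠ 0)
    (hb : b ≠ 0) {f : ℝ × ℝ → ℝ≥0∞} (hf : Measurable f)
    (hN : haarState.map (expectPair (observable a₀ a) (observable b₀ b)) = volume.withDensity f) :
    haarState.map (uncertaintyPair (observable a₀ a) (observable b₀ b)) =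
      volume.withDensity (Set.indicator (Set.Ico 0 ‖a‖ ×ˢ Set.Ico 0 ‖b‖) (fun p =>
        weight ‖a‖ ‖b‖ p * (f (rootPlus a₀ ‖a‖ p.1, rootPlus b₀ ‖b‖ p.2) +
          f (rootPlus a₀ ‖a‖ p.1, rootMinus b₀ ‖b‖ p.2)))) := by
  have hU : MeasurableSet (Set.Ioo 0 ‖a‖ ×ˢ Set.Ioo 0 ‖b‖) :=
    measurableSet_Ioo.prod measurableSet_Ioo
  have h₁ := isInverseBranch_rootPlus a₀ b₀ ‖a‖ ‖b‖
  have h₂ := isInverseBranch_rootMinus a₀ b₀ ‖a‖ ‖b‖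
  have hf₁ : Measurable fun p : ℝ × ℝ => f (rootPlus a₀ ‖a‖ p.1, rootPlus b₀ ‖b‖ p.2) :=
    hf.comp h₁.measurable
  have hf₂ : Measurable fun p : ℝ × ℝ => f (rootPlus a₀ ‖a‖ p.1, rootMinus b₀ ‖b‖ p.2) :=
    hf.comp h₂.measurable
  have hae : (Set.Ioo 0 ‖a‖ ×ˢ Set.Ioo 0 ‖b‖ : Set (ℝ × ℝ)) =ᵐ[volume]
      (Set.Ico 0 ‖a‖ ×ˢ Set.Ico 0 ‖b‖ : Set (ℝ × ℝ)) := by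
    rw [Measure.volume_eq_prod]
    exact Measure.set_prod_ae_eq Ioo_ae_eq_Ico Ioo_ae_eq_Ico
  rw [map_uncertaintyPair a₀ b₀ ha hb, hN,
    genComp_withDensity hU h₁.measurable h₁.differentiableAt h₁.leftInvOn.injOn h₁.det_ne_zero hf,
    genComp_withDensity hU h₂.measurable h₂.differentiableAt h₂.leftInvOn.injOn h₂.det_ne_zero hf,
    ← withDensity_add_left hf₁, ← withDensity_mul _ (hf₁.add hf₂) (measurable_weight _ _),
    ← withDensity_indicator hU]
  refine withDensity_congr_ae ((indicator_ae_eq_of_ae_eq_set hae).trans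
    (Filter.Eventually.of_forall fun p => ?_))
  congr 1
  ext q
  exact mul_comm _ _

end QubitUncertainty

theorem mainTheorem1 (a₀ b₀ : ℝ) (a b : EuclideanSpace ℝ (Fin 3)) (ha : a ≠ 0) (hb : b ≠ 0) :
    -- the density formula, with `f_{⟨A⟩,⟨B⟩}` the generalized density of `(⟨A⟩_ψ, ⟨B⟩_ψ)`
    haarState.map (uncertaintyPair (observable a₀ a) (observable b₀ b)) =
      (genComp (Set.Ioo 0 ‖a‖ ×ˢ Set.Ioo 0 ‖b‖)
          (fun p => (rootPlus a₀ ‖a‖ p.1, rootPlus b₀ ‖b‖ p.2))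
          (haarState.map (expectPair (observable a₀ a) (observable b₀ b))) +
        genComp (Set.Ioo 0 ‖a‖ ×ˢ Set.Ioo 0 ‖b‖)
          (fun p => (rootPlus a₀ ‖a‖ p.1, rootMinus b₀ ‖b‖ p.2))
          (haarState.map (expectPair (observable a₀ a) (observable b₀ b)))).withDensity
        (weight ‖a‖ ‖b‖) ∧
    -- for linearly independent `a`, `b` all densities are functions
    (LinearIndependent ℝ ![a, b] →
      HasPDF (expectPair (observable a₀ a) (observable b₀ b)) haarState volume ∧
      pdf (expectPair (observable a₀ a) (observable b₀ b)) haarState volume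
        =ᵐ[volume] expectDensity a₀ b₀ a b ∧
      HasPDF (uncertaintyPair (observable a₀ a) (observable b₀ b)) haarState volume ∧
      pdf (uncertaintyPair (observable a₀ a) (observable b₀ b)) haarState volume
        =ᵐ[volume] Set.indicator (Set.Ico 0 ‖a‖ ×ˢ Set.Ico 0 ‖b‖) (fun p =>
          weight ‖a‖ ‖b‖ p *
            (pdf (expectPair (observable a₀ a) (observable b₀ b)) haarState volume
                (rootPlus a₀ ‖a‖ p.1, rootPlus b₀ ‖b‖ p.2) +
              pdf (expectPair (observable a₀ a) (observable b₀ b)) haarState volume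
                (rootPlus a₀ ‖a‖ p.1, rootMinus b₀ ‖b‖ p.2)))) ∧
    -- for `b = κ a`, `f_{⟨A⟩,⟨B⟩}(r,s) = δ((s - b₀) - κ (r - a₀)) f_{⟨A⟩}(r)`
    (∀ κ : ℝ, b = κ • a →
      haarState.map (expectPair (observable a₀ a) (observable b₀ b)) =
        (ENNReal.ofReal (1 / (2 * ‖a‖)) •
          volume.restrict (Set.Icc (a₀ - ‖a‖) (a₀ + ‖a‖))).map
          (fun r => (r, b₀ + κ * (r - a₀)))) := by
  refine ⟨map_uncertaintyPair a₀ b₀ ha hb, fun h => ?_, fun κ hκ => ?_⟩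
  · have hA := hasPDF_expectPair a₀ b₀ ha h
    have hM := map_uncertaintyPair_eq_withDensity a₀ b₀ ha hb (measurable_pdf _ _ _)
      (map_eq_withDensity_pdf (expectPair (observable a₀ a) (observable b₀ b)) haarState volume)
    have hmeas : Measurable (Set.indicator (Set.Ico 0 ‖a‖ ×ˢ Set.Ico 0 ‖b‖) (fun p =>
          weight ‖a‖ ‖b‖ p *
            (pdf (expectPair (observable a₀ a) (observable b₀ b)) haarState volume
                (rootPlus a₀ ‖a‖ p.1, rootPlus b₀ ‖b‖ p.2) +
              pdf (expectPair (observable a₀ a) (observable b₀ b)) haarState volume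
                (rootPlus a₀ ‖a‖ p.1, rootMinus b₀ ‖b‖ p.2)))) :=
      ((measurable_weight _ _).mul
        (((measurable_pdf _ _ _).comp (isInverseBranch_rootPlus a₀ b₀ ‖a‖ ‖b‖).measurable).add
          ((measurable_pdf _ _ _).comp
            (isInverseBranch_rootMinus a₀ b₀ ‖a‖ ‖b‖).measurable))).indicator
        (measurableSet_Ico.prod measurableSet_Ico)
    have hΔ : Measurable (uncertaintyPair (observable a₀ a) (observable b₀ b)) := by
      rw [uncertaintyPair_observable]
      exact ((measurable_deviation _ _).prodMap (measurable_deviation _ _)).comp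
        (measurable_expectPair _ _)
    refine ⟨hA, ?_, hasPDF_of_map_eq_withDensity hΔ.aemeasurable _ hmeas.aemeasurable hM, ?_⟩
    · rw [pdf_def, map_expectPair_eq_withDensity a₀ b₀ ha h]
      exact Measure.rnDeriv_withDensity _ (measurable_expectDensity a₀ b₀ a b)
    · rw [pdf_def (X := uncertaintyPair _ _), hM]
      exact Measure.rnDeriv_withDensity _ hmeas
  · rw [← map_expect_observable a₀ ha, Measure.map_map (by fun_prop) (measurable_expect _)]
    congr 1
    ext ψ
    · rfl
    · have h := expect_observable_smul_add_smul a 0 κ 0 ψ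
      rw [smul_zero, add_zero, zero_mul, add_zero, ← hκ] at h
      simp only [expectPair, Function.comp_apply]
      rw [expect_observable b₀ b, expect_observable a₀ a, h, add_sub_cancel_left]
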